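/- **Lemma (rate-splitting for the cq-MAC).** Let $\mathcal X_1,\mathcal X_2$ be finite alphabets, $\mathcal H^B$ a finite-dimensional Hilbert space, and $(x_1,x_2)\mapsto\rho^B_{x_1x_2}$ a classical-quantum multiple access channel, i.e. each $\rho^B_{x_1x_2}$ is a density operator on $\mathcal H^B$. Let $p_{X_1},p_{X_2}$ be probability distributions on $\mathcal X_1,\mathcal X_2$, put $$\theta^{X_1X_2B}=\sum_{x_1,x_2}p_{X_1}(x_1)p_{X_2}(x_2)\,|x_1\rangle\langle x_1|\otimes|x_2\rangle\langle x_2|\otimes\rho^B_{x_1x_2},$$ and let $\alpha_p=(I(X_1;B)_\theta,\,I(X_2;B|X_1)_\theta)$ and $\beta_p=(I(X_1;B|X_2)_\theta,\,I(X_2;B)_\theta)$, where $I(A;B)=H(A)+H(B)-H(AB)$ and $I(A;B|C)=H(AC)+H(BC)-H(ABC)-H(C)$ with the von Neumann entropy $H(\sigma)=-\mathrm{Tr}\,\sigma\log_2\sigma$ of the reduced states. Let $(R_1,R_2)$ lie on the closed line segment between $\alpha_p$ and $\beta_p$. Then there are finite alphabets $\mathcal U,\mathcal V$, probability distributions $p_U,p_V$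 on them, a function $f:\mathcal U\times\mathcal V\to\mathcal X_2$ such that $f(U,V)\sim p_{X_2}$ for independent $U\sim p_U$, $V\sim p_V$, and rates $R_{2u},R_{2v}\ge 0$ with $R_{2u}+R_{2v}=R_2$, such that for all $\epsilon,\delta>0$ and all sufficiently large $n$ the following holds. Let $m_1$, $m_{2u}$, $m_{2v}$ range over message sets of sizes $\lceil 2^{n(R_1-\delta)}\rceil$, $\lceil 2^{n(R_{2u}-\delta/2)}\rceil$ and $\lceil 2^{n(R_{2v}-\delta/2)}\rceil$ (so that Sender 2 has at least $2^{n(R_2-\delta)}$ messages $m_2=(m_{2u},m_{2v})$). Given codebooks $\{x_1^n(m_1)\}$, $\{u^n(m_{2u})\}$, $\{v^n(m_{2v})\}$, Sender 1 sends $x_1^n(m_1)$, Sender 2 sends $x_2^n(m_{2u},m_{2v})$ with letters $x_{2,i}=f(u_i(m_{2u}),v_i(m_{2v}))$, and the channel output is $\bigotimes_{i=1}^n\rho_{x_{1,i}x_{2,i}}$. The receiver decodes successively in the order $m_{2u}\to m_1\to m_{2v}$: he measures a POVM $\{\Lambda_{m_{2u}}\}$, then a POVM $\{\Lambda_{m_1|m_{2u}}\}$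 that may depend on the first outcome, then a POVM $\{\Lambda_{m_{2v}|m_{2u},m_1}\}$ that may depend on the first two outcomes, where a POVM $\{\Lambda_m\}$ with outcome $m$ maps the state $\sigma$ to $\sqrt{\Lambda_m}\,\sigma\sqrt{\Lambda_m}$ (unnormalized); an error occurs unless the outcomes are exactly $m_{2u}$, $m_1$, $m_{2v}$. 1. If all letters of the three codebooks are drawn independently, from $p_{X_1}$, $p_U$ and $p_V$ respectively, then there are such successive decoders, depending on the codebooks, for which the expectation over the codebooks of the error probability averaged over all messages is at most $\epsilon$. 2. In particular, there are fixed codebooks and a successive decoder with average error probability at most $\epsilon$; that is, $(R_1,R_2)$ is achieved. -/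

import Mathlib

open scoped Matrix ComplexOrder MatrixOrder Kronecker

noncomputable section

namespace CQMac

/-! ### States, entropies and the corner points -/

/-- Density operators on the finite-dimensional Hilbert space `ℂ^d`. -/
def IsDensity {d : Type*} [Fintype d] (ρ : Matrix d d ℂ) : Prop :=
  ρ.PosSemidef ∧ ρ.trace = 1

/-- The von Neumann entropy `H(ρ) = - Tr (ρ log₂ ρ)`; the logarithm of a matrix is taken in the
continuous functional calculus, with the convention `0 log 0 = 0`. -/
def entropy {d : Type*} [Fintype d] [DecidableEq d] (ρ : Matrix d d ℂ) : ℝ :=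
  -((ρ * cfc (fun t : ℝ => Real.logb 2 t) ρ).trace.re)

/-- Partial trace over the first factor of `A ⊗ B`. -/
def traceFst {a b : Type*} [Fintype a] (τ : Matrix (a × b) (a × b) ℂ) : Matrix b b ℂ :=
  Matrix.of fun j j' => ∑ i, τ (i, j) (i, j')

/-- Partial trace over the second factor of `A ⊗ B`. -/
def traceSnd {a b : Type*} [Fintype b] (τ : Matrix (a × b) (a × b) ℂ) : Matrix a a ℂ :=
  Matrix.of fun i i' => ∑ j, τ (i, j) (i', j)

/-- Partial trace over the middle factor of `A ⊗ (B ⊗ C)`. -/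
def traceMid {a b c : Type*} [Fintype b] (τ : Matrix (a × b × c) (a × b × c) ℂ) :
    Matrix (a × c) (a × c) ℂ :=
  Matrix.of fun i i' => ∑ j, τ (i.1, j, i.2) (i'.1, j, i'.2)

/-- Partial trace over the last factor of `A ⊗ (B ⊗ C)`. -/
def traceLast {a b c : Type*} [Fintype c] (τ : Matrix (a × b × c) (a × b × c) ℂ) :
    Matrix (a × b) (a × b) ℂ :=
  Matrix.of fun i i' => ∑ k, τ (i.1, i.2, k) (i'.1, i'.2, k)

section Info

variable {X₁ X₂ d : Type*} [Fintype X₁] [DecidableEq X₁] [Fintype X₂] [DecidableEq X₂]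
  [Fintype d] [DecidableEq d]

/-- The quantum mutual information `I(A;B) = H(A) + H(B) - H(AB)`. -/
def mutualInfo {a b : Type*} [Fintype a] [DecidableEq a] [Fintype b] [DecidableEq b]
    (τ : Matrix (a × b) (a × b) ℂ) : ℝ :=
  entropy (traceSnd τ) + entropy (traceFst τ) - entropy τ

/-- The classical-quantum state
`θ = ∑ p₁(x₁) p₂(x₂) |x₁⟩⟨x₁| ⊗ |x₂⟩⟨x₂| ⊗ ρ_{x₁ x₂}` on `X₁ X₂ B`. -/
def theta (ρ : X₁ → X₂ → Matrix d d ℂ) (p₁ : X₁ → ℝ) (p₂ : X₂ → ℝ) :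
    Matrix (X₁ × X₂ × d) (X₁ × X₂ × d) ℂ :=
  ∑ x₁, ∑ x₂, ((p₁ x₁ * p₂ x₂ : ℝ) : ℂ) •
    (Matrix.single x₁ x₁ (1 : ℂ) ⊗ₖ (Matrix.single x₂ x₂ (1 : ℂ) ⊗ₖ ρ x₁ x₂))

/-- `I(X₁;B)_θ` -/
def infoX₁ (θ : Matrix (X₁ × X₂ × d) (X₁ × X₂ × d) ℂ) : ℝ :=
  mutualInfo (traceMid θ)

/-- `I(X₂;B)_θ` -/
def infoX₂ (θ : Matrix (X₁ × X₂ × d) (X₁ × X₂ × d) ℂ) : ℝ :=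
  mutualInfo (traceFst θ)

/-- `I(X₁;B|X₂)_θ = H(X₁X₂) + H(X₂B) - H(X₁X₂B) - H(X₂)` -/
def infoX₁GivenX₂ (θ : Matrix (X₁ × X₂ × d) (X₁ × X₂ × d) ℂ) : ℝ :=
  entropy (traceLast θ) + entropy (traceFst θ) - entropy θ - entropy (traceSnd (traceFst θ))

/-- `I(X₂;B|X₁)_θ = H(X₁X₂) + H(X₁B) - H(X₁X₂B) - H(X₁)` -/
def infoX₂GivenX₁ (θ : Matrix (X₁ × X₂ × d) (X₁ × X₂ × d) ℂ) : ℝ :=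
  entropy (traceLast θ) + entropy (traceMid θ) - entropy θ - entropy (traceSnd θ)

/-- The corner point `α_p = (I(X₁;B), I(X₂;B|X₁))`. -/
def alphaCorner (ρ : X₁ → X₂ → Matrix d d ℂ) (p₁ : X₁ → ℝ) (p₂ : X₂ → ℝ) : ℝ × ℝ :=
  (infoX₁ (theta ρ p₁ p₂), infoX₂GivenX₁ (theta ρ p₁ p₂))

/-- The corner point `β_p = (I(X₁;B|X₂), I(X₂;B))`. -/
def betaCorner (ρ : X₁ → X₂ → Matrix d d ℂ) (p₁ : X₁ → ℝ) (p₂ : X₂ → ℝ) : ℝ × ℝ :=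
  (infoX₁GivenX₂ (theta ρ p₁ p₂), infoX₂ (theta ρ p₁ p₂))

end Info

/-! ### Split codes and successive decoding -/

/-- The output `ρ_{x₁ⁿ, x₂ⁿ} = ⨂ᵢ ρ_{x₁ᵢ, x₂ᵢ}` of `n` uses of the channel. -/
def output {X₁ X₂ d : Type*} {n : ℕ} (ρ : X₁ → X₂ → Matrix d d ℂ)
    (x₁ : Fin n → X₁) (x₂ : Fin n → X₂) : Matrix (Fin n → d) (Fin n → d) ℂ :=
  Matrix.of fun a b => ∏ i, ρ (x₁ i) (x₂ i) (a i) (b i)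

/-- A POVM on `ℂ^D` with outcomes in `M`. -/
structure POVM (M D : Type*) [Fintype M] [DecidableEq D] where
  op : M → Matrix D D ℂ
  posSemidef : ∀ m, (op m).PosSemidef
  sum_eq_one : ∑ m, op m = 1

/-- A successive decoder for the order `m₂ᵤ → m₁ → m₂ᵥ`: a POVM for `m₂ᵤ`, a POVM for `m₁`
conditional on the first outcome, and a POVM for `m₂ᵥ` conditional on the first two outcomes. -/
structure SuccessiveDecoder (Mu M₁ Mv D : Type*) [Fintype Mu] [Fintype M₁] [Fintype Mv]
    [DecidableEq D] where
  decU : POVM Mu D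
  dec1 : Mu → POVM M₁ D
  decV : Mu → M₁ → POVM Mv D

/-- The probability that the three successive measurements, applied to the state `σ`, return
`mu`, then `m₁`, then `mv`. A measurement `{Λ_m}` with outcome `m` takes the
(unnormalized) state `σ` to `√Λ_m σ √Λ_m`. -/
def SuccessiveDecoder.prob {Mu M₁ Mv D : Type*} [Fintype Mu] [Fintype M₁] [Fintype Mv]
    [Fintype D] [DecidableEq D] (Λ : SuccessiveDecoder Mu M₁ Mv D)
    (mu : Mu) (m₁ : M₁) (mv : Mv) (σ : Matrix D D ℂ) : ℝ :=
  let σ' := CFC.sqrt (Λ.decU.op mu) * σ * CFC.sqrt (Λ.decU.op mu)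
  let σ'' := CFC.sqrt ((Λ.dec1 mu).op m₁) * σ' * CFC.sqrt ((Λ.dec1 mu).op m₁)
  ((Λ.decV mu m₁).op mv * σ'').trace.re

section Codes

variable {X₁ X₂ U V d : Type*} [Fintype d] [DecidableEq d] {n : ℕ}
  {Mu M₁ Mv : Type*} [Fintype Mu] [Fintype M₁] [Fintype Mv]

/-- The average probability of error: Sender 1 sends `m₁` as `x₁ⁿ(m₁)`, Sender 2 sends
`(mu, mv)` as the word with letters `f (uᵢ(mu)) (vᵢ(mv))`, and the receiver errs unless his
successive measurements return `mu`, `m₁` and `mv`. -/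
def avgError (ρ : X₁ → X₂ → Matrix d d ℂ) (f : U → V → X₂)
    (cx : M₁ → Fin n → X₁) (cu : Mu → Fin n → U) (cv : Mv → Fin n → V)
    (Λ : SuccessiveDecoder Mu M₁ Mv (Fin n → d)) : ℝ :=
  (1 / ((Fintype.card M₁ : ℝ) * ((Fintype.card Mu : ℝ) * (Fintype.card Mv : ℝ)))) *
    ∑ m₁, ∑ mu, ∑ mv,
      (1 - Λ.prob mu m₁ mv (output ρ (cx m₁) (fun i => f (cu mu i) (cv mv i))))

/-- The probability of a codebook all of whose letters are drawn independently from `p`. -/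
def codebookProb {X M : Type*} [Fintype M] (p : X → ℝ) (c : M → Fin n → X) : ℝ :=
  ∏ m, ∏ i, p (c m i)

/-- The expected average probability of error over random codebooks generated from `p₁`, `pU`
and `pV`; the decoder `Λ` may depend on the codebooks. -/
def expectedError [Fintype X₁] [Fintype U] [Fintype V] [DecidableEq M₁] [DecidableEq Mu]
    [DecidableEq Mv] (ρ : X₁ → X₂ → Matrix d d ℂ) (f : U → V → X₂)
    (p₁ : X₁ → ℝ) (pU : U → ℝ) (pV : V → ℝ)
    (Λ : (M₁ → Fin n → X₁) → (Mu → Fin n → U) → (Mv → Fin n → V) →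
      SuccessiveDecoder Mu M₁ Mv (Fin n → d)) : ℝ :=
  ∑ cx : M₁ → Fin n → X₁, ∑ cu : Mu → Fin n → U, ∑ cv : Mv → Fin n → V,
    codebookProb p₁ cx * codebookProb pU cu * codebookProb pV cv *
      avgError ρ f cx cu cv (Λ cx cu cv)

end Codes

/-- The number `⌈2^{nR}⌉` of messages of a code of block length `n` and rate `R`. -/
def numMsg (n : ℕ) (R : ℝ) : ℕ := ⌈(2 : ℝ) ^ ((n : ℝ) * R)⌉₊

open Classical in
/-- If `U ∼ pU` and `V ∼ pV` are independent then `f(U,V) ∼ p₂`. -/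
def MixesTo {U V X₂ : Type*} [Fintype U] [Fintype V] (f : U → V → X₂)
    (pU : U → ℝ) (pV : V → ℝ) (p₂ : X₂ → ℝ) : Prop :=
  ∀ x, ∑ u, ∑ v, (if f u v = x then pU u * pV v else 0) = p₂ x

end CQMac

end

/-! Sender 2 is split by an erasure. Write (R₁, R₂) = a α + b β with a + b = 1. Let V be distributed
as X₂, let U be an erasure with probability a and otherwise an independent copy of X₂, and let f(u,
v) be u, or v if u is erased. An erased U leaves B in its average state, so I(U;B) = b I(X₂;B).
Given U, Sender 1 faces the channel averaged over X₂ with weight a and the channel with X₂ known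
with weight b, so I(X₁;B|U) = a I(X₁;B) + b I(X₁;B|X₂) = R₁. Finally V matters only under erasure,
so I(V;B|U X₁) = a I(X₂;B|X₁). The first and third quantities are the split rates and sum to R₂. The
convex weight is itself the splitting parameter, so no continuity argument is needed
(`holevo_splitProb`, `sum_splitProb_mul_holevo`, `sum_splitProb_prod_mul_holevo`).

Decodability below these rates comes from one random coding theorem for a channel whose receiver
knows an i.i.d. state s, `exists_decoder_sideInformation`. It is used with s trivial, s = u and s =
(u, x₁); codewords not yet decoded are independent of everything used so far and average into the
effective channel. The theorem rests on two typical projectors, P for the average output given s and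
Q for a codeword's output, and on a square-root measurement built from P Q P. By the Hayashi–Nagaoka
inequality the error is governed by the atypical mass and by the M - 1 wrong codewords, each
contributing at most 2^{-n(H₁-δ)} 2^{n(H₂+δ)}, where H₁ - H₂ is the conditional information.

Each measurement is analysed on the undisturbed state. Gentle measurement (`successive_bound`) turns
the three separate errors into a bound for the whole sequence, and Jensen's inequality moves the
square roots outside the codebook average. Some fixed codebook does at least as well as the average.
-/

set_option linter.unusedSectionVars false

namespace CQMac

/-! ### Operator inequalities: Hayashi–Nagaoka and gentle measurement. -/

section MatrixBounds

variable {D : Type*} [Fintype D] [DecidableEq D]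

lemma conj_nonneg {A : Matrix D D ℂ} (hA : 0 ≤ A) {B : Matrix D D ℂ} (hB : B.IsHermitian) :
    0 ≤ B * A * B := by
  have h := (Matrix.nonneg_iff_posSemidef.1 hA).conjTranspose_mul_mul_same B
  rw [hB.eq] at h
  exact Matrix.nonneg_iff_posSemidef.2 h

lemma conj_le_conj {A A' : Matrix D D ℂ} (hA : A ≤ A') {B : Matrix D D ℂ} (hB : B.IsHermitian) :
    B * A * B ≤ B * A' * B := by
  have h := conj_nonneg (sub_nonneg.2 hA) hB
  rw [mul_sub, sub_mul] at h
  exact sub_nonneg.1 h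

lemma exists_sqrt {A : Matrix D D ℂ} (hA : 0 ≤ A) :
    ∃ B : Matrix D D ℂ, 0 ≤ B ∧ B * B = A :=
  ⟨CFC.sqrt A, CFC.sqrt_nonneg A, CFC.sqrt_mul_sqrt_self A hA⟩

lemma isHermitian_of_nonneg {A : Matrix D D ℂ} (hA : 0 ≤ A) : A.IsHermitian :=
  (Matrix.nonneg_iff_posSemidef.1 hA).isHermitian

lemma trace_mul_re_nonneg {A B : Matrix D D ℂ} (hA : 0 ≤ A) (hB : 0 ≤ B) :
    0 ≤ (A * B).trace.re := by
  obtain ⟨C, hC, rfl⟩ := exists_sqrt hA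
  have h := conj_nonneg hB (isHermitian_of_nonneg hC)
  rw [mul_assoc, Matrix.trace_mul_comm]
  exact (Complex.nonneg_iff.1 (Matrix.nonneg_iff_posSemidef.1 h).trace_nonneg).1

lemma trace_mul_re_mono {A A' B : Matrix D D ℂ} (hA : A ≤ A') (hB : 0 ≤ B) :
    (A * B).trace.re ≤ (A' * B).trace.re := by
  have h := trace_mul_re_nonneg (sub_nonneg.2 hA) hB
  rw [sub_mul, Matrix.trace_sub, Complex.sub_re] at h
  linarith

/-- Operator monotonicity of the square root. -/
lemma le_of_mul_self_le {A B : Matrix D D ℂ} (hA : 0 ≤ A) (hB : 0 ≤ B) (h : A * A ≤ B * B) :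
    A ≤ B := by
  have hAh := isHermitian_of_nonneg hA
  have hBh := isHermitian_of_nonneg hB
  have hH : (B - A).IsHermitian := hBh.sub hAh
  rw [Matrix.le_iff, hH.posSemidef_iff_eigenvalues_nonneg]
  intro i
  -- If `v` is a unit eigenvector of `B - A` with eigenvalue μ < 0, then v*(B² - A²)v = μ (v*Av +
  -- v*Bv) must be nonnegative, although v*Av = v*Bv - μ makes the bracket positive.
  by_contra hneg
  simp only [Pi.zero_apply, not_le] at hneg
  set μ := hH.eigenvalues i with hμ
  set v : D → ℂ := ⇑(hH.eigenvectorBasis i) with hv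
  have hev : (B - A) *ᵥ v = μ • v := hH.mulVec_eigenvectorBasis i
  have hvec : star v ᵥ* (B - A) = μ • star v := by
    have := congrArg star hev
    rw [Matrix.star_mulVec, hH.eq] at this
    rw [this]
    ext j; simp
  have hqA := (Matrix.nonneg_iff_posSemidef.1 hA).dotProduct_mulVec_nonneg v
  have hqB := (Matrix.nonneg_iff_posSemidef.1 hB).dotProduct_mulVec_nonneg v
  have hq := (Matrix.le_iff.1 h).dotProduct_mulVec_nonneg v
  have hnorm : star v ⬝ᵥ v = 1 := by
    have := hH.eigenvectorBasis.orthonormal.1 i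
    rw [EuclideanSpace.norm_eq, Real.sqrt_eq_one] at this
    rw [dotProduct]
    simp only [Pi.star_apply, RCLike.star_def, Complex.conj_mul', hv]
    exact_mod_cast this
  have e1 : star v ⬝ᵥ ((B - A) *ᵥ v) = μ := by
    rw [hev, dotProduct_smul, hnorm]; simp
  have e2 : star v ⬝ᵥ ((B * B - A * A) *ᵥ v) =
      μ * (star v ⬝ᵥ (A *ᵥ v) + star v ⬝ᵥ (B *ᵥ v)) := by
    have : B * B - A * A = (B - A) * B + A * (B - A) := by noncomm_ring
    rw [this, Matrix.add_mulVec, ← Matrix.mulVec_mulVec, ← Matrix.mulVec_mulVec, hev,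
      dotProduct_add, Matrix.dotProduct_mulVec, hvec, Matrix.mulVec_smul, smul_dotProduct,
      dotProduct_smul]
    simp; ring
  rw [e2] at hq
  rw [Matrix.sub_mulVec, dotProduct_sub] at e1
  rw [Complex.nonneg_iff] at hqA hqB hq
  have e1r := congrArg Complex.re e1
  simp at e1r hq
  have : 0 < -μ := by linarith
  have h1 : (star v ⬝ᵥ B *ᵥ v).re < (star v ⬝ᵥ A *ᵥ v).re := by linarith
  nlinarith [hqA.1, hqB.1, hq.1]

/-- The Hayashi–Nagaoka inequality for an invertible square root `G` of `S + T`. -/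
lemma hayashi_nagaoka {S T G G' : Matrix D D ℂ} (hS : 0 ≤ S) (hS1 : S ≤ 1) (hT : 0 ≤ T)
    (hG : 0 ≤ G) (hGG : G * G = S + T) (hG' : G'.IsHermitian) (h1 : G * G' = 1)
    (h2 : G' * G = 1) :
    1 - G' * S * G' ≤ (2 : ℝ) • (1 - S) + (4 : ℝ) • T := by
  obtain ⟨R, hR, hRS⟩ := exists_sqrt hS
  -- S ≤ 1 gives S² ≤ S ≤ G², and the square root is operator monotone.
  have hSG : S ≤ G := by
    refine le_of_mul_self_le hS hG ?_
    calc S * S = R * S * R := by rw [← hRS]; noncomm_ring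
      _ ≤ R * 1 * R := conj_le_conj hS1 (isHermitian_of_nonneg hR)
      _ = S := by rw [mul_one, hRS]
      _ ≤ S + T := le_add_of_nonneg_right hT
      _ = G * G := hGG.symm
  have hTG : T ≤ G * G := by rw [hGG]; exact le_add_of_nonneg_left hS
  have hK : (G' - 1).IsHermitian := hG'.sub Matrix.isHermitian_one
  have a1 : 1 - G' * S * G' = G' * T * G' := by
    have : G' * (G * G) * G' = 1 := by
      rw [← mul_assoc, h2, one_mul, h1]
    rw [← this, hGG]; noncomm_ring
  -- With K = G' - 1, the right side minus (K + 1) T (K + 1) is (K - 1) T (K - 1) ≥ 0.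
  have a2 : G' * T * G' ≤ (2 : ℝ) • T + (2 : ℝ) • ((G' - 1) * T * (G' - 1)) := by
    have := conj_nonneg hT (hK.sub Matrix.isHermitian_one)
    refine sub_nonneg.1 (this.trans_eq ?_)
    simp only [two_smul]
    noncomm_ring
  have a3 : (G' - 1) * T * (G' - 1) ≤ (1 - G) * (1 - G) := by
    refine (conj_le_conj hTG hK).trans_eq ?_
    have b1 : (G' - 1) * G = 1 - G := by rw [sub_mul, h2, one_mul]
    have b2 : G * (G' - 1) = 1 - G := by rw [mul_sub, h1, mul_one]
    rw [← mul_assoc, b1, mul_assoc, b2]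
  have a4 : (1 - G) * (1 - G) ≤ 1 - S + T := by
    have : (1 - G) * (1 - G) = 1 + (S + T) - (2 : ℝ) • G := by
      rw [← hGG, two_smul]; noncomm_ring
    rw [this]
    have h3 := smul_le_smul_of_nonneg_left hSG (zero_le_two (α := ℝ))
    calc 1 + (S + T) - (2 : ℝ) • G ≤ 1 + (S + T) - (2 : ℝ) • S := sub_le_sub_left h3 _
      _ = 1 - S + T := by rw [two_smul]; abel
  rw [a1]
  calc G' * T * G' ≤ (2 : ℝ) • T + (2 : ℝ) • ((G' - 1) * T * (G' - 1)) := a2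
    _ ≤ (2 : ℝ) • T + (2 : ℝ) • (1 - S + T) :=
      add_le_add_right (smul_le_smul_of_nonneg_left (a3.trans a4) zero_le_two) _
    _ = _ := by module

/-- The Hilbert–Schmidt norm. -/
noncomputable def hsNorm (A : Matrix D D ℂ) : ℝ :=
  ‖(WithLp.toLp 2 fun p : D × D => A p.1 p.2 : EuclideanSpace ℂ (D × D))‖

lemma hsNorm_nonneg (A : Matrix D D ℂ) : 0 ≤ hsNorm A := norm_nonneg _

lemma hsNorm_add_le (A B : Matrix D D ℂ) : hsNorm (A + B) ≤ hsNorm A + hsNorm B :=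
  norm_add_le (WithLp.toLp 2 fun p : D × D => A p.1 p.2 : EuclideanSpace ℂ (D × D))
    (WithLp.toLp 2 fun p : D × D => B p.1 p.2)

lemma hsNorm_sub_le (A B : Matrix D D ℂ) : hsNorm A - hsNorm B ≤ hsNorm (A - B) :=
  norm_sub_norm_le (WithLp.toLp 2 fun p : D × D => A p.1 p.2 : EuclideanSpace ℂ (D × D))
    (WithLp.toLp 2 fun p : D × D => B p.1 p.2)

lemma hsNorm_neg (A : Matrix D D ℂ) : hsNorm (-A) = hsNorm A :=
  norm_neg (WithLp.toLp 2 fun p : D × D => A p.1 p.2 : EuclideanSpace ℂ (D × D))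

lemma hsNorm_sq (A : Matrix D D ℂ) : hsNorm A ^ 2 = (Aᴴ * A).trace.re := by
  rw [hsNorm, EuclideanSpace.norm_eq, Real.sq_sqrt (by positivity), Fintype.sum_prod_type_right]
  simp only [Matrix.trace, Matrix.diag, Matrix.mul_apply, Matrix.conjTranspose_apply,
    RCLike.star_def, Complex.conj_mul', Complex.re_sum]
  norm_cast

lemma hsNorm_mul_le {A : Matrix D D ℂ} (hA : A.IsHermitian) (hA1 : A * A ≤ 1)
    (B : Matrix D D ℂ) : hsNorm (A * B) ≤ hsNorm B := by
  refine le_of_sq_le_sq ?_ (hsNorm_nonneg _)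
  rw [hsNorm_sq, hsNorm_sq, Matrix.conjTranspose_mul, hA.eq]
  have h := trace_mul_re_mono hA1 (Matrix.nonneg_iff_posSemidef.2
    (Matrix.posSemidef_self_mul_conjTranspose B))
  rw [one_mul, Matrix.trace_mul_comm B, ← mul_assoc, Matrix.trace_mul_comm] at h
  simpa [mul_assoc] using h

lemma mul_le_self_of_contraction {A : Matrix D D ℂ} (hA : 0 ≤ A) (hA1 : A * A ≤ 1) :
    A * A ≤ A := by
  have h1 : A ≤ 1 := le_of_mul_self_le hA zero_le_one (by simpa using hA1)
  have hh := isHermitian_of_nonneg hA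
  -- A decomposition into two congruences of positive matrices.
  have e : A - A * A = A * (1 - A) * A + (1 - A) * A * (1 - A) := by noncomm_ring
  refine sub_nonneg.1 ?_
  rw [e]
  exact add_nonneg (conj_nonneg (sub_nonneg.2 h1) hh)
    (conj_nonneg hA (Matrix.isHermitian_one.sub hh))

/-- Gentle measurement: the disturbance in Hilbert–Schmidt norm of `√σ`. -/
lemma hsNorm_gentle {A s : Matrix D D ℂ} (hA : 0 ≤ A) (hA1 : A * A ≤ 1) (hs : 0 ≤ s)
    (htr : (s * s).trace.re = 1) :
    hsNorm (A * s - s) ≤ √(1 - (A * A * (s * s)).trace.re) := by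
  refine Real.le_sqrt_of_sq_le ?_
  have hh := isHermitian_of_nonneg hA
  have hsh := isHermitian_of_nonneg hs
  have hss : 0 ≤ s * s := by simpa using conj_nonneg (zero_le_one (α := Matrix D D ℂ)) hsh
  have e : A * s - s = (A - 1) * s := by rw [sub_mul, one_mul]
  rw [e, hsNorm_sq, Matrix.conjTranspose_mul, hsh.eq, (hh.sub Matrix.isHermitian_one).eq]
  have e2 : (s * (A - 1) * ((A - 1) * s)).trace = ((A - 1) * (A - 1) * (s * s)).trace := by
    rw [mul_assoc, Matrix.trace_mul_comm]; simp only [mul_assoc]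
  -- The difference of the two sides is 2 (A - A²).
  have e3 : (A - 1) * (A - 1) ≤ 1 - A * A := by
    have h := mul_le_self_of_contraction hA hA1
    have h2 := add_nonneg (sub_nonneg.2 h) (sub_nonneg.2 h)
    refine sub_nonneg.1 (h2.trans_eq ?_)
    noncomm_ring
  rw [e2]
  refine (trace_mul_re_mono e3 hss).trans_eq ?_
  rw [sub_mul, one_mul, Matrix.trace_sub, Complex.sub_re, htr]

/-- Three successive measurements with operators `A₁, A₂, A₃` on a state `s²`. -/
lemma successive_bound {A₁ A₂ A₃ σ : Matrix D D ℂ} (h₁ : 0 ≤ A₁) (h₁' : A₁ * A₁ ≤ 1)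
    (h₂ : 0 ≤ A₂) (h₂' : A₂ * A₂ ≤ 1) (h₃ : 0 ≤ A₃) (h₃' : A₃ * A₃ ≤ 1)
    (hσ : 0 ≤ σ) (htr : σ.trace.re = 1) :
    1 - ((A₃ * A₃) * (A₂ * (A₁ * σ * A₁) * A₂)).trace.re ≤
      2 * (√(1 - (A₁ * A₁ * σ).trace.re) + √(1 - (A₂ * A₂ * σ).trace.re) +
        √(1 - (A₃ * A₃ * σ).trace.re)) := by
  obtain ⟨s, hs, rfl⟩ := exists_sqrt hσ
  have hsh := isHermitian_of_nonneg hs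
  have hh₁ := isHermitian_of_nonneg h₁
  have hh₂ := isHermitian_of_nonneg h₂
  have hh₃ := isHermitian_of_nonneg h₃
  have g₁ := hsNorm_gentle h₁ h₁' hs htr
  have g₂ := hsNorm_gentle h₂ h₂' hs htr
  have g₃ := hsNorm_gentle h₃ h₃' hs htr
  set E := √(1 - (A₁ * A₁ * (s * s)).trace.re) + √(1 - (A₂ * A₂ * (s * s)).trace.re) +
        √(1 - (A₃ * A₃ * (s * s)).trace.re)
  have hns : hsNorm s = 1 := by
    have : hsNorm s ^ 2 = 1 := by rw [hsNorm_sq, hsh.eq, htr]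
    nlinarith [hsNorm_nonneg s]
  have key : hsNorm (A₃ * (A₂ * (A₁ * s)) - s) ≤ E := by
    -- Telescoping: each term is the disturbance of the untouched `s` by one operator, followed by
    -- contractions, which do not increase the norm.
    have e : A₃ * (A₂ * (A₁ * s)) - s =
        (A₃ * (A₂ * (A₁ * s - s)) + A₃ * (A₂ * s - s)) + (A₃ * s - s) := by noncomm_ring
    rw [e]
    refine (hsNorm_add_le _ _).trans (add_le_add ((hsNorm_add_le _ _).trans ?_) g₃)
    exact add_le_add ((hsNorm_mul_le hh₃ h₃' _).trans ((hsNorm_mul_le hh₂ h₂' _).trans g₁))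
      ((hsNorm_mul_le hh₃ h₃' _).trans g₂)
  have hlow : 1 - E ≤ hsNorm (A₃ * (A₂ * (A₁ * s))) := by
    have := hsNorm_sub_le s (A₃ * (A₂ * (A₁ * s)))
    rw [← hsNorm_neg (s - _), neg_sub, hns] at this
    linarith
  have hprob : ((A₃ * A₃) * (A₂ * (A₁ * (s * s) * A₁) * A₂)).trace.re =
      hsNorm (A₃ * (A₂ * (A₁ * s))) ^ 2 := by
    rw [hsNorm_sq]
    simp only [Matrix.conjTranspose_mul, hh₁.eq, hh₂.eq, hh₃.eq, hsh.eq]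
    have : A₃ * A₃ * (A₂ * (A₁ * (s * s) * A₁) * A₂) =
      (A₃ * (A₃ * (A₂ * (A₁ * s)))) * (s * A₁ * A₂) := by noncomm_ring
    rw [this, Matrix.trace_mul_comm]
    simp only [mul_assoc]
  rw [hprob]
  -- With h the norm of the final vector, 1 - h² ≤ 2 (1 - h) ≤ 2 E, whatever the sign of 1 - E.
  nlinarith [sq_nonneg (hsNorm (A₃ * (A₂ * (A₁ * s)))), hsNorm_nonneg (A₃ * (A₂ * (A₁ * s))),
    sq_nonneg (1 - hsNorm (A₃ * (A₂ * (A₁ * s))))]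

end MatrixBounds

/-! ### Independent letters: resampling, Jensen and Chebyshev. -/

section ProductLaw

variable {ι X : Type*} [Fintype ι] [DecidableEq ι] [Fintype X]

/-- The probability of the word `c` whose letters are drawn independently from `p`. -/
def wordProb (p : X → ℝ) (c : ι → X) : ℝ := ∏ i, p (c i)

lemma wordProb_nonneg {p : X → ℝ} (hp : p ∈ stdSimplex ℝ X) (c : ι → X) : 0 ≤ wordProb p c :=
  Finset.prod_nonneg fun _ _ => hp.1 _

lemma sum_wordProb {p : X → ℝ} (hp : p ∈ stdSimplex ℝ X) : ∑ c : ι → X, wordProb p c = 1 := by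
  simp only [wordProb]
  rw [← Fintype.prod_sum]
  simp [hp.2]

lemma wordProb_mem_stdSimplex {p : X → ℝ} (hp : p ∈ stdSimplex ℝ X) :
    (wordProb p : (ι → X) → ℝ) ∈ stdSimplex ℝ (ι → X) :=
  ⟨wordProb_nonneg hp, sum_wordProb hp⟩

/-- Exchanging the letter at position `m` with an external letter. -/
def exchange (m : ι) (cx : (ι → X) × X) : (ι → X) × X := (Function.update cx.1 m cx.2, cx.1 m)

lemma exchange_involutive (m : ι) : Function.Involutive (exchange (X := X) m) := by
  rintro ⟨c, x⟩
  simp [exchange]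

lemma wordProb_update (p : X → ℝ) (c : ι → X) (m : ι) (x : X) :
    wordProb p (Function.update c m x) * p (c m) = wordProb p c * p x := by
  simp only [wordProb]
  rw [← Finset.mul_prod_erase _ _ (Finset.mem_univ m),
    ← Finset.mul_prod_erase (a := m) _ (fun i => p (c i)) (Finset.mem_univ m)]
  have : ∏ i ∈ Finset.univ.erase m, p (Function.update c m x i) =
      ∏ i ∈ Finset.univ.erase m, p (c i) :=
    Finset.prod_congr rfl fun i hi => by rw [Function.update_of_ne (Finset.ne_of_mem_erase hi)]
  rw [this]
  simp; ring

/-- Redrawing one letter does not change an expectation. -/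
lemma sum_wordProb_resample {p : X → ℝ} (hp : p ∈ stdSimplex ℝ X) (m : ι) (G : (ι → X) → ℝ) :
    ∑ c, wordProb p c * G c =
      ∑ c, wordProb p c * ∑ x, p x * G (Function.update c m x) := by
  -- Swapping the letter at `m` with a fresh one is an involution that preserves the joint weight of
  -- the word and the extra letter.
  have e := Equiv.sum_comp (exchange_involutive (X := X) m).toPerm
    (fun cx : (ι → X) × X => wordProb p cx.1 * p cx.2 * G cx.1)
  rw [Fintype.sum_prod_type, Fintype.sum_prod_type] at e
  have e1 : ∑ c, wordProb p c * G c = ∑ c, ∑ x, wordProb p c * p x * G c := by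
    refine Finset.sum_congr rfl fun c _ => ?_
    rw [← Finset.sum_mul, ← Finset.mul_sum, hp.2, mul_one]
  rw [e1, ← e]
  refine Finset.sum_congr rfl fun c _ => ?_
  rw [Finset.mul_sum]
  refine Finset.sum_congr rfl fun x _ => ?_
  change wordProb p (Function.update c m x) * p (c m) * G (Function.update c m x) = _
  rw [wordProb_update, mul_assoc]

lemma sum_wordProb_apply {p : X → ℝ} (hp : p ∈ stdSimplex ℝ X) (m : ι) (g : X → ℝ) :
    ∑ c : ι → X, wordProb p c * g (c m) = ∑ x, p x * g x := by
  rw [sum_wordProb_resample hp m]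
  simp only [Function.update_self]
  rw [← Finset.sum_mul, sum_wordProb hp, one_mul]

lemma sum_wordProb_apply₂ {p : X → ℝ} (hp : p ∈ stdSimplex ℝ X) {m m' : ι} (h : m ≠ m')
    (g : X → X → ℝ) :
    ∑ c : ι → X, wordProb p c * g (c m) (c m') = ∑ x, p x * ∑ y, p y * g x y := by
  rw [sum_wordProb_resample hp m]
  simp only [Function.update_self, Function.update_of_ne h.symm]
  rw [sum_wordProb_apply hp m' (fun y => ∑ x, p x * g x y)]
  simp only [Finset.mul_sum]
  rw [Finset.sum_comm]
  exact Finset.sum_congr rfl fun _ _ => Finset.sum_congr rfl fun _ _ => by ring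

/-- Jensen for the concave square root; it lets error bounds of gentle-measurement type be averaged
over codewords, states and codebooks. -/
lemma sum_mul_sqrt_le {w e : X → ℝ} (hw : w ∈ stdSimplex ℝ X) (he : ∀ x, 0 ≤ e x) :
    ∑ x, w x * √(e x) ≤ √(∑ x, w x * e x) := by
  have := Real.strictConcaveOn_sqrt.concaveOn.le_map_sum (t := Finset.univ) (w := w) (p := e)
    (fun i _ => hw.1 i) hw.2 (fun i _ => he i)
  simpa using this

/-- The variance of a sum of independent letters. -/
lemma sum_wordProb_sq {q : X → ℝ} (hq : q ∈ stdSimplex ℝ X) {h : X → ℝ}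
    (h0 : ∑ x, q x * h x = 0) :
    ∑ a : ι → X, wordProb q a * (∑ i, h (a i)) ^ 2 = Fintype.card ι * ∑ x, q x * h x ^ 2 := by
  have e : ∀ i j : ι, ∑ a : ι → X, wordProb q a * (h (a i) * h (a j)) =
      if i = j then ∑ x, q x * h x ^ 2 else 0 := by
    intro i j
    split_ifs with hij
    · subst hij
      rw [sum_wordProb_apply hq i (fun x => h x * h x)]
      simp only [sq]
    · rw [sum_wordProb_apply₂ hq hij (fun x y => h x * h y)]
      have : ∀ x, ∑ y, q y * (h x * h y) = 0 := fun x => by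
        calc ∑ y, q y * (h x * h y) = h x * ∑ y, q y * h y := by
              rw [Finset.mul_sum]; exact Finset.sum_congr rfl fun _ _ => by ring
          _ = 0 := by rw [h0, mul_zero]
      simp [this]
  calc ∑ a : ι → X, wordProb q a * (∑ i, h (a i)) ^ 2
      = ∑ i, ∑ j, ∑ a : ι → X, wordProb q a * (h (a i) * h (a j)) := by
        have : ∀ a : ι → X, wordProb q a * (∑ i, h (a i)) ^ 2 =
            ∑ i, ∑ j, wordProb q a * (h (a i) * h (a j)) := fun a => by
          rw [sq, Finset.sum_mul_sum]; simp only [Finset.mul_sum]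
        simp only [this]
        rw [Finset.sum_comm]
        exact Finset.sum_congr rfl fun _ _ => Finset.sum_comm
    _ = _ := by simp [e]

/-- Chebyshev's inequality for a sum of independent letters. -/
lemma chebyshev {q : X → ℝ} (hq : q ∈ stdSimplex ℝ X) (g : X → ℝ) {n : ℕ} (hn : 0 < n)
    {δ : ℝ} (hδ : 0 < δ) :
    ∑ a : Fin n → X, wordProb q a *
        (if |∑ i, g (a i) - n * ∑ x, q x * g x| ≤ n * δ then 0 else 1) ≤
      (∑ x, q x * (g x - ∑ y, q y * g y) ^ 2) / (n * δ ^ 2) := by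
  set μ := ∑ y, q y * g y with hμ
  have h0 : ∑ x, q x * (g x - μ) = 0 := by
    simp only [mul_sub, Finset.sum_sub_distrib, ← Finset.sum_mul, hq.2, one_mul]
    rw [← hμ, sub_self]
  have hn' : (0 : ℝ) < n := by exact_mod_cast hn
  have key := sum_wordProb_sq (ι := Fin n) hq h0
  rw [Fintype.card_fin] at key
  rw [le_div_iff₀ (by positivity)]
  have : (∑ a : Fin n → X, wordProb q a *
        (if |∑ i, g (a i) - n * μ| ≤ n * δ then 0 else 1)) * (n * δ) ^ 2 ≤
      n * ∑ x, q x * (g x - μ) ^ 2 := by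
    rw [← key, Finset.sum_mul]
    refine Finset.sum_le_sum fun a _ => ?_
    rw [mul_assoc]
    refine mul_le_mul_of_nonneg_left ?_ (wordProb_nonneg hq a)
    have e : ∑ i, (g (a i) - μ) = ∑ i, g (a i) - n * μ := by
      rw [Finset.sum_sub_distrib]; simp
    rw [e]
    split_ifs with h
    · rw [zero_mul]; positivity
    · rw [one_mul, ← sq_abs (∑ i, g (a i) - n * μ)]
      push Not at h
      exact pow_le_pow_left₀ (by positivity) h.le 2
  have h2 : (n : ℝ) * ((∑ a : Fin n → X, wordProb q a *
        (if |∑ i, g (a i) - n * μ| ≤ n * δ then 0 else 1)) * (n * δ ^ 2)) ≤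
      n * ∑ x, q x * (g x - μ) ^ 2 := by
    refine le_trans (le_of_eq ?_) this
    ring
  exact le_of_mul_le_mul_left h2 hn'

end ProductLaw

/-! ### Calculus with an explicit eigenbasis. -/

section Spectral

variable {D : Type*} [Fintype D] [DecidableEq D]

/-- The matrix with eigenvalues `l` and eigenvectors the columns of `W`. -/
noncomputable def specMat (W : Matrix D D ℂ) (l : D → ℝ) : Matrix D D ℂ :=
  W * Matrix.diagonal (fun j => (l j : ℂ)) * Wᴴ

lemma specMat_apply (W : Matrix D D ℂ) (l : D → ℝ) (i j : D) :
    specMat W l i j = ∑ k, W i k * l k * star (W j k) := by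
  simp [specMat, Matrix.mul_apply, Matrix.diagonal_apply]

lemma specMat_mul {W : Matrix D D ℂ} (hW : Wᴴ * W = 1) (l l' : D → ℝ) :
    specMat W l * specMat W l' = specMat W (fun j => l j * l' j) := by
  have : specMat W l * specMat W l' = W * (Matrix.diagonal (fun j => (l j : ℂ)) * (Wᴴ * W) *
      Matrix.diagonal (fun j => (l' j : ℂ))) * Wᴴ := by
    simp only [specMat]; noncomm_ring
  rw [this, hW, mul_one, Matrix.diagonal_mul_diagonal, specMat]
  simp

lemma specMat_one {W : Matrix D D ℂ} (hW : Wᴴ * W = 1) : specMat W (fun _ => 1) = 1 := by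
  simp [specMat, mul_eq_one_comm.1 hW]

lemma specMat_isHermitian (W : Matrix D D ℂ) (l : D → ℝ) : (specMat W l).IsHermitian := by
  rw [specMat, Matrix.IsHermitian]
  simp only [Matrix.conjTranspose_mul, Matrix.conjTranspose_conjTranspose,
    Matrix.diagonal_conjTranspose, mul_assoc]
  congr 3
  ext j; simp

lemma specMat_nonneg (W : Matrix D D ℂ) {l : D → ℝ} (hl : ∀ j, 0 ≤ l j) : 0 ≤ specMat W l := by
  refine Matrix.nonneg_iff_posSemidef.2 (Matrix.PosSemidef.mul_mul_conjTranspose_same ?_ W)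
  exact Matrix.PosSemidef.diagonal fun j => by simpa using hl j

lemma specMat_sub (W : Matrix D D ℂ) (l l' : D → ℝ) :
    specMat W l - specMat W l' = specMat W (fun j => l j - l' j) := by
  ext i j
  simp only [Matrix.sub_apply, specMat_apply, ← Finset.sum_sub_distrib]
  exact Finset.sum_congr rfl fun _ _ => by push_cast; ring

lemma specMat_add (W : Matrix D D ℂ) (l l' : D → ℝ) :
    specMat W l + specMat W l' = specMat W (fun j => l j + l' j) := by
  ext i j
  simp only [Matrix.add_apply, specMat_apply, ← Finset.sum_add_distrib]
  exact Finset.sum_congr rfl fun _ _ => by push_cast; ring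

lemma specMat_smul (W : Matrix D D ℂ) (r : ℝ) (l : D → ℝ) :
    r • specMat W l = specMat W (fun j => r * l j) := by
  ext i j
  simp only [Matrix.smul_apply, specMat_apply, Finset.smul_sum]
  exact Finset.sum_congr rfl fun _ _ => by simp; ring

lemma specMat_mono (W : Matrix D D ℂ) {l l' : D → ℝ} (h : ∀ j, l j ≤ l' j) :
    specMat W l ≤ specMat W l' := by
  rw [← sub_nonneg, specMat_sub]
  exact specMat_nonneg W fun j => sub_nonneg.2 (h j)

lemma trace_specMat {W : Matrix D D ℂ} (hW : Wᴴ * W = 1) (l : D → ℝ) :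
    (specMat W l).trace = ((∑ j, l j : ℝ) : ℂ) := by
  rw [specMat, Matrix.trace_mul_comm, ← mul_assoc, hW, one_mul, Matrix.trace_diagonal]
  simp

lemma exists_specMat {A : Matrix D D ℂ} (hA : A.IsHermitian) :
    ∃ (W : Matrix D D ℂ) (l : D → ℝ), Wᴴ * W = 1 ∧ A = specMat W l := by
  refine ⟨hA.eigenvectorUnitary, hA.eigenvalues, ?_, ?_⟩
  · exact Unitary.coe_star_mul_self hA.eigenvectorUnitary
  · exact hA.spectral_theorem

lemma conj_specMat {W : Matrix D D ℂ} (hW : Wᴴ * W = 1) (l : D → ℝ) :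
    Wᴴ * specMat W l * W = Matrix.diagonal (fun j => (l j : ℂ)) := by
  have : Wᴴ * specMat W l * W =
      (Wᴴ * W) * Matrix.diagonal (fun j => (l j : ℂ)) * (Wᴴ * W) := by
    rw [specMat]; noncomm_ring
  rw [this, hW, one_mul, mul_one]

lemma IsDensity.exists_specMat {A : Matrix D D ℂ} (hA : IsDensity A) :
    ∃ (W : Matrix D D ℂ) (l : D → ℝ), Wᴴ * W = 1 ∧ A = specMat W l ∧ (∀ j, 0 ≤ l j) ∧
      ∑ j, l j = 1 := by
  obtain ⟨W, l, hW, rfl⟩ := CQMac.exists_specMat hA.1.isHermitian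
  refine ⟨W, l, hW, rfl, fun j => ?_, ?_⟩
  · have h := (hA.1.conjTranspose_mul_mul_same W).diag_nonneg (i := j)
    rw [conj_specMat hW] at h
    simpa using h
  · have h := hA.2
    rw [trace_specMat hW] at h
    exact_mod_cast h

open Polynomial in
lemma aeval_specMat {W : Matrix D D ℂ} (hW : Wᴴ * W = 1) (l : D → ℝ) (q : ℝ[X]) :
    aeval (specMat W l) q = specMat W (fun j => q.eval (l j)) := by
  induction q using Polynomial.induction_on' with
  | add p q hp hq =>
    rw [map_add, hp, hq, specMat_add]
    simp
  | monomial k a =>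
    have hpow : specMat W l ^ k = specMat W (fun j => l j ^ k) := by
      induction k with
      | zero => simp [specMat_one hW]
      | succ k ih => rw [pow_succ, ih, specMat_mul hW]; simp [pow_succ]
    rw [aeval_monomial, hpow, ← Algebra.smul_def, specMat_smul]
    simp

/-- On a finite spectrum any function agrees with a Lagrange interpolant, and polynomials act
entrywise on the eigenvalues. No continuity of `f` is needed, which matters for the logarithm at 0.
-/
lemma cfc_specMat {W : Matrix D D ℂ} (hW : Wᴴ * W = 1) (l : D → ℝ) (f : ℝ → ℝ) :
    cfc f (specMat W l) = specMat W (fun j => f (l j)) := by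
  have hsa : IsSelfAdjoint (specMat W l) := specMat_isHermitian W l
  have hfin : (spectrum ℝ (specMat W l)).Finite := Matrix.finite_real_spectrum
  set s : Finset ℝ := hfin.toFinset ∪ Finset.univ.image l with hs
  set q := Lagrange.interpolate s id f
  have hq : ∀ x ∈ s, q.eval x = f x := fun x hx =>
    Lagrange.eval_interpolate_at_node (v := id) f Function.injective_id.injOn hx
  have h1 : cfc f (specMat W l) = cfc q.eval (specMat W l) :=
    cfc_congr fun x hx => (hq x (by simp [hs, hx])).symm
  rw [h1, cfc_polynomial q _ hsa, aeval_specMat hW]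
  congr 1
  ext j
  exact hq _ (by simp [hs])

/-- The entropy function `-t log₂ t`. -/
noncomputable def eta (t : ℝ) : ℝ := -(t * Real.logb 2 t)

lemma eta_mul (s t : ℝ) : eta (s * t) = s * eta t + t * eta s := by
  by_cases hs : s = 0
  · simp [hs, eta]
  by_cases ht : t = 0
  · simp [ht, eta]
  rw [eta, Real.logb_mul hs ht, eta, eta]
  ring

lemma concaveOn_eta : ConcaveOn ℝ (Set.Ici 0) eta := by
  have h := Real.concaveOn_negMulLog.smul (c := (Real.log 2)⁻¹)
    (inv_nonneg.2 (Real.log_nonneg one_le_two))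
  refine h.congr fun t _ => ?_
  simp [eta, Real.negMulLog, Real.logb]
  ring

lemma entropy_specMat {W : Matrix D D ℂ} (hW : Wᴴ * W = 1) (l : D → ℝ) :
    entropy (specMat W l) = ∑ j, eta (l j) := by
  rw [entropy, cfc_specMat hW, specMat_mul hW, trace_specMat hW, Complex.ofReal_re]
  simp [eta]

end Spectral

/-! ### Ensembles and concavity of the entropy. -/

section Average

variable {X D : Type*} [Fintype X] [Fintype D] [DecidableEq D]

/-- The average state of an ensemble. -/
noncomputable def avgState (p : X → ℝ) (ρ : X → Matrix D D ℂ) : Matrix D D ℂ :=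
  ∑ x, (p x : ℂ) • ρ x

lemma avgState_apply (p : X → ℝ) (ρ : X → Matrix D D ℂ) (i j : D) :
    avgState p ρ i j = ∑ x, (p x : ℂ) * ρ x i j := by
  simp [avgState, Matrix.sum_apply]

lemma IsDensity.nonneg {A : Matrix D D ℂ} (hA : IsDensity A) : 0 ≤ A :=
  Matrix.nonneg_iff_posSemidef.2 hA.1

lemma isDensity_avgState {p : X → ℝ} (hp : p ∈ stdSimplex ℝ X) {ρ : X → Matrix D D ℂ}
    (hρ : ∀ x, IsDensity (ρ x)) : IsDensity (avgState p ρ) := by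
  constructor
  · exact Matrix.posSemidef_sum _ fun x _ => (hρ x).1.smul (by exact_mod_cast hp.1 x)
  · rw [avgState, Matrix.trace_sum]
    simp only [Matrix.trace_smul, (hρ _).2, smul_eq_mul, mul_one]
    exact_mod_cast hp.2

/-- The Holevo information of an ensemble. -/
noncomputable def holevo (p : X → ℝ) (ρ : X → Matrix D D ℂ) : ℝ :=
  entropy (avgState p ρ) - ∑ x, p x * entropy (ρ x)

lemma sum_normSq_col {U : Matrix D D ℂ} (hU : Uᴴ * U = 1) (j : D) :
    ∑ i, Complex.normSq (U i j) = 1 := by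
  have h := congrFun (congrFun hU j) j
  simp only [Matrix.mul_apply, Matrix.conjTranspose_apply, RCLike.star_def,
    Matrix.one_apply_eq, ← Complex.normSq_eq_conj_mul_self] at h
  exact_mod_cast h

/-- In another orthonormal basis the diagonal arises from the spectrum through the doubly stochastic
matrix |U i j|², and `eta` is concave. Applied in the eigenbasis of an average state, this reduces
concavity of the entropy to concavity of `eta`. -/
lemma sum_eta_diag_ge {A W : Matrix D D ℂ} (hA : IsDensity A) (hW : Wᴴ * W = 1) :
    entropy A ≤ ∑ j, eta ((Wᴴ * A * W) j j).re := by
  obtain ⟨V, l, hV, rfl, hl, -⟩ := hA.exists_specMat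
  set U := Vᴴ * W with hUdef
  have hU : Uᴴ * U = 1 := by
    rw [hUdef, Matrix.conjTranspose_mul, Matrix.conjTranspose_conjTranspose]
    have : Wᴴ * V * (Vᴴ * W) = Wᴴ * (V * Vᴴ) * W := by noncomm_ring
    rw [this, mul_eq_one_comm.1 hV, mul_one, hW]
  have hU' : ∀ i, ∑ j, Complex.normSq (U i j) = 1 := fun i => by
    have h := sum_normSq_col (U := Uᴴ) (by simpa using mul_eq_one_comm.1 hU) i
    simpa using h
  have hdiag : ∀ j, ((Wᴴ * specMat V l * W) j j).re = ∑ i, Complex.normSq (U i j) * l i := by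
    intro j
    have e : Wᴴ * specMat V l * W = Uᴴ * Matrix.diagonal (fun j => (l j : ℂ)) * U := by
      rw [hUdef, specMat, Matrix.conjTranspose_mul, Matrix.conjTranspose_conjTranspose]
      noncomm_ring
    rw [e, Matrix.mul_apply, Complex.re_sum]
    refine Finset.sum_congr rfl fun i _ => ?_
    rw [Matrix.mul_diagonal, Matrix.conjTranspose_apply, RCLike.star_def, mul_right_comm,
      ← Complex.normSq_eq_conj_mul_self]
    norm_cast
  rw [entropy_specMat hV]
  calc ∑ i, eta (l i) = ∑ i, (∑ j, Complex.normSq (U i j)) * eta (l i) := by simp [hU']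
    _ = ∑ j, ∑ i, Complex.normSq (U i j) * eta (l i) := by
      rw [Finset.sum_comm]; simp only [Finset.sum_mul]
    _ ≤ _ := by
      refine Finset.sum_le_sum fun j _ => ?_
      rw [hdiag]
      exact concaveOn_eta.le_map_sum (w := fun i => Complex.normSq (U i j)) (p := l)
        (fun i _ => Complex.normSq_nonneg _) (sum_normSq_col hU j) (fun i _ => hl i)

/-- Concavity of the von Neumann entropy. -/
lemma holevo_nonneg {p : X → ℝ} (hp : p ∈ stdSimplex ℝ X) {ρ : X → Matrix D D ℂ}
    (hρ : ∀ x, IsDensity (ρ x)) : 0 ≤ holevo p ρ := by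
  obtain ⟨W, l, hW, hA, hl, -⟩ := (isDensity_avgState hp hρ).exists_specMat
  have hdiag : ∀ j, l j = ∑ x, p x * ((Wᴴ * ρ x * W) j j).re := by
    intro j
    have h := congrFun (congrFun (conj_specMat hW l) j) j
    rw [← hA, Matrix.diagonal_apply_eq, avgState, Finset.mul_sum, Finset.sum_mul,
      Matrix.sum_apply] at h
    have h2 := congrArg Complex.re h
    rw [Complex.ofReal_re, Complex.re_sum] at h2
    rw [← h2]
    refine Finset.sum_congr rfl fun x _ => ?_
    rw [mul_smul_comm, smul_mul_assoc, Matrix.smul_apply, smul_eq_mul, Complex.re_ofReal_mul]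
  rw [holevo, sub_nonneg, hA, entropy_specMat hW]
  calc ∑ x, p x * entropy (ρ x) ≤ ∑ x, p x * ∑ j, eta ((Wᴴ * ρ x * W) j j).re :=
        Finset.sum_le_sum fun x _ =>
          mul_le_mul_of_nonneg_left (sum_eta_diag_ge (hρ x) hW) (hp.1 x)
    _ = ∑ j, ∑ x, p x * eta ((Wᴴ * ρ x * W) j j).re := by
        rw [Finset.sum_comm]; simp only [Finset.mul_sum]
    _ ≤ _ := by
      refine Finset.sum_le_sum fun j _ => ?_
      rw [hdiag j]
      refine concaveOn_eta.le_map_sum (fun x _ => hp.1 x) hp.2 fun x _ => ?_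
      have h := ((hρ x).1.conjTranspose_mul_mul_same W).diag_nonneg (i := j)
      exact (Complex.nonneg_iff.1 h).1

end Average

/-! ### Entropy and marginals of classical-quantum states. -/

section ClassicalQuantum

variable {X D : Type*} [Fintype X] [DecidableEq X] [Fintype D] [DecidableEq D]

/-- The block-diagonal matrix with blocks `ρ x`. -/
def blockMat (ρ : X → Matrix D D ℂ) : Matrix (X × D) (X × D) ℂ :=
  Matrix.of fun i j => if i.1 = j.1 then ρ i.1 i.2 j.2 else 0

lemma blockMat_mul (ρ σ : X → Matrix D D ℂ) :
    blockMat ρ * blockMat σ = blockMat fun x => ρ x * σ x := by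
  ext ⟨x, i⟩ ⟨y, j⟩
  simp only [blockMat, Matrix.mul_apply, Matrix.of_apply, Fintype.sum_prod_type]
  rw [Finset.sum_eq_single x]
  · by_cases h : x = y <;> simp [h]
  · intro z _ hz
    simp [hz.symm]
  · simp

lemma blockMat_conjTranspose (ρ : X → Matrix D D ℂ) :
    (blockMat ρ)ᴴ = blockMat fun x => (ρ x)ᴴ := by
  ext ⟨x, i⟩ ⟨y, j⟩
  simp only [blockMat, Matrix.conjTranspose_apply, Matrix.of_apply]
  by_cases h : x = y
  · simp [h]
  · simp [h, Ne.symm h]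

lemma blockMat_one : blockMat (fun _ : X => (1 : Matrix D D ℂ)) = 1 := by
  ext ⟨x, i⟩ ⟨y, j⟩
  by_cases h : x = y
  · simp [blockMat, h, Matrix.one_apply]
  · simp [blockMat, h, Matrix.one_apply]

lemma blockMat_specMat (W : X → Matrix D D ℂ) (l : X → D → ℝ) :
    blockMat (fun x => specMat (W x) (l x)) = specMat (blockMat W) (fun i => l i.1 i.2) := by
  rw [specMat, blockMat_conjTranspose]
  have : (Matrix.diagonal fun j : X × D => ((l j.1 j.2 : ℝ) : ℂ)) =
      blockMat fun x => Matrix.diagonal fun j => ((l x j : ℝ) : ℂ) := by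
    ext ⟨x, i⟩ ⟨y, j⟩
    by_cases h : x = y
    · subst h; simp [blockMat, Matrix.diagonal_apply]
    · simp [blockMat, h, Matrix.diagonal_apply]
  rw [this, blockMat_mul, blockMat_mul]
  rfl

/-- The classical-quantum state `∑ p(x) |x⟩⟨x| ⊗ ρ x`. -/
noncomputable def cqState (p : X → ℝ) (ρ : X → Matrix D D ℂ) : Matrix (X × D) (X × D) ℂ :=
  blockMat fun x => (p x : ℂ) • ρ x

/-- The spectrum consists of the products p(x) l(x, j), on which `eta` obeys the product rule
`eta_mul`: the classical chain rule. -/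
lemma entropy_cqState (p : X → ℝ) {ρ : X → Matrix D D ℂ}
    (hρ : ∀ x, IsDensity (ρ x)) :
    entropy (cqState p ρ) = ∑ x, eta (p x) + ∑ x, p x * entropy (ρ x) := by
  choose W l hW hA hl h1 using fun x => (hρ x).exists_specMat
  have e : cqState p ρ = specMat (blockMat W) fun i => p i.1 * l i.1 i.2 := by
    rw [← blockMat_specMat W fun x j => p x * l x j, cqState]
    congr 1
    ext1 x
    rw [hA x, ← specMat_smul]
    exact (RCLike.real_smul_eq_coe_smul (K := ℂ) _ _).symm
  have hb : (blockMat W)ᴴ * blockMat W = 1 := by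
    rw [blockMat_conjTranspose, blockMat_mul]
    simp only [hW, blockMat_one]
  rw [e, entropy_specMat hb, Fintype.sum_prod_type, ← Finset.sum_add_distrib]
  refine Finset.sum_congr rfl fun x _ => ?_
  simp only [eta_mul]
  rw [Finset.sum_add_distrib, ← Finset.sum_mul, h1, one_mul, ← Finset.mul_sum, hA x,
    entropy_specMat (hW x), add_comm]

lemma diagonal_eq_specMat (p : X → ℝ) :
    Matrix.diagonal (fun x => (p x : ℂ)) = specMat 1 p := by
  simp [specMat]

lemma entropy_diagonal (p : X → ℝ) :
    entropy (Matrix.diagonal fun x => (p x : ℂ)) = ∑ x, eta (p x) := by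
  rw [diagonal_eq_specMat, entropy_specMat (by simp)]

lemma isDensity_diagonal {p : X → ℝ} (hp : p ∈ stdSimplex ℝ X) :
    IsDensity (Matrix.diagonal fun x => (p x : ℂ)) := by
  refine ⟨Matrix.PosSemidef.diagonal fun x => by simpa using hp.1 x, ?_⟩
  rw [Matrix.trace_diagonal]
  exact_mod_cast hp.2

lemma isDensity_cqState {p : X → ℝ} (hp : p ∈ stdSimplex ℝ X) {ρ : X → Matrix D D ℂ}
    (hρ : ∀ x, IsDensity (ρ x)) : IsDensity (cqState p ρ) := by
  choose W l hW hA hl h1 using fun x => (hρ x).exists_specMat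
  have e : cqState p ρ = specMat (blockMat W) fun i => p i.1 * l i.1 i.2 := by
    rw [← blockMat_specMat W fun x j => p x * l x j, cqState]
    congr 1
    ext1 x
    rw [hA x, ← specMat_smul]
    exact (RCLike.real_smul_eq_coe_smul (K := ℂ) _ _).symm
  refine ⟨?_, ?_⟩
  · rw [e]
    exact Matrix.nonneg_iff_posSemidef.1
      (specMat_nonneg _ fun j => mul_nonneg (hp.1 _) (hl _ _))
  · have : (cqState p ρ).trace = ∑ x, (p x : ℂ) * (ρ x).trace := by
      simp [cqState, blockMat, Matrix.trace, Fintype.sum_prod_type, Finset.mul_sum]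
    rw [this]
    simp only [(hρ _).2, mul_one]
    exact_mod_cast hp.2

lemma traceSnd_cqState (p : X → ℝ) {ρ : X → Matrix D D ℂ} (hρ : ∀ x, IsDensity (ρ x)) :
    traceSnd (cqState p ρ) = Matrix.diagonal fun x => (p x : ℂ) := by
  ext x y
  by_cases h : x = y
  · subst h
    have := (hρ x).2
    simp only [Matrix.trace, Matrix.diag] at this
    simp [traceSnd, cqState, blockMat, ← Finset.mul_sum, this]
  · simp [traceSnd, cqState, blockMat, h]

lemma traceFst_cqState (p : X → ℝ) (ρ : X → Matrix D D ℂ) :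
    traceFst (cqState p ρ) = avgState p ρ := by
  ext i j
  simp [traceFst, cqState, blockMat, avgState_apply]

end ClassicalQuantum

/-! ### The corner points as averages of Holevo informations. -/

section CornerPoints

variable {X₁ X₂ d : Type*} [Fintype X₁] [DecidableEq X₁] [Fintype X₂] [DecidableEq X₂]
  [Fintype d] [DecidableEq d]

lemma theta_eq_cqState (ρ : X₁ → X₂ → Matrix d d ℂ) (p₁ : X₁ → ℝ) (p₂ : X₂ → ℝ) :
    theta ρ p₁ p₂ = cqState p₁ fun x₁ => cqState p₂ (ρ x₁) := by
  ext ⟨x, y, i⟩ ⟨x', y', j⟩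
  simp only [theta, Matrix.sum_apply, Matrix.smul_apply, Matrix.kroneckerMap_apply,
    Matrix.single_apply, cqState, blockMat, Matrix.of_apply]
  rw [Finset.sum_eq_single x, Finset.sum_eq_single y]
  · by_cases h : x = x' <;> by_cases h' : y = y' <;> simp [h, h']
    ring
  · intro z _ hz; simp [hz]
  · simp
  · intro z _ hz; simp [hz]
  · simp

lemma traceMid_theta (ρ : X₁ → X₂ → Matrix d d ℂ) (p₁ : X₁ → ℝ) (p₂ : X₂ → ℝ) :
    traceMid (theta ρ p₁ p₂) = cqState p₁ fun x₁ => avgState p₂ (ρ x₁) := by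
  rw [theta_eq_cqState]
  ext ⟨x, i⟩ ⟨x', j⟩
  by_cases h : x = x' <;>
    simp [traceMid, cqState, blockMat, h, avgState_apply, Finset.mul_sum]

lemma traceFst_theta (ρ : X₁ → X₂ → Matrix d d ℂ) (p₁ : X₁ → ℝ) (p₂ : X₂ → ℝ) :
    traceFst (theta ρ p₁ p₂) = cqState p₂ fun x₂ => avgState p₁ fun x₁ => ρ x₁ x₂ := by
  rw [theta_eq_cqState, traceFst_cqState]
  ext ⟨x, i⟩ ⟨x', j⟩
  by_cases h : x = x' <;>
    simp [cqState, blockMat, h, avgState_apply, Finset.mul_sum, mul_left_comm]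

lemma traceLast_theta (ρ : X₁ → X₂ → Matrix d d ℂ) (hρ : ∀ x₁ x₂, IsDensity (ρ x₁ x₂))
    (p₁ : X₁ → ℝ) (p₂ : X₂ → ℝ) :
    traceLast (theta ρ p₁ p₂) =
      cqState p₁ fun _ => Matrix.diagonal fun x₂ => (p₂ x₂ : ℂ) := by
  rw [theta_eq_cqState]
  ext ⟨x, y⟩ ⟨x', y'⟩
  by_cases h : x = x'
  · have := congrFun (congrFun (traceSnd_cqState p₂ (hρ x)) y) y'
    subst h
    simp only [traceSnd, Matrix.of_apply] at this
    simp [traceLast, cqState, blockMat, ← this, Finset.mul_sum]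
  · simp [traceLast, cqState, blockMat, h]

variable {ρ : X₁ → X₂ → Matrix d d ℂ} (hρ : ∀ x₁ x₂, IsDensity (ρ x₁ x₂))
  {p₁ : X₁ → ℝ} (hp₁ : p₁ ∈ stdSimplex ℝ X₁) {p₂ : X₂ → ℝ} (hp₂ : p₂ ∈ stdSimplex ℝ X₂)

include hρ hp₂ in
lemma infoX₁_theta :
    infoX₁ (theta ρ p₁ p₂) = holevo p₁ fun x₁ => avgState p₂ (ρ x₁) := by
  have h : ∀ x₁, IsDensity (avgState p₂ (ρ x₁)) := fun x₁ => isDensity_avgState hp₂ (hρ x₁)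
  rw [infoX₁, mutualInfo, traceMid_theta, traceSnd_cqState _ h, traceFst_cqState,
    entropy_diagonal, entropy_cqState _ h, holevo]
  ring

include hρ hp₁ in
lemma infoX₂_theta :
    infoX₂ (theta ρ p₁ p₂) = holevo p₂ fun x₂ => avgState p₁ fun x₁ => ρ x₁ x₂ := by
  have h : ∀ x₂, IsDensity (avgState p₁ fun x₁ => ρ x₁ x₂) :=
    fun x₂ => isDensity_avgState hp₁ fun x₁ => hρ x₁ x₂
  rw [infoX₂, mutualInfo, traceFst_theta, traceSnd_cqState _ h, traceFst_cqState,
    entropy_diagonal, entropy_cqState _ h, holevo]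
  ring

include hρ hp₁ hp₂ in
lemma entropy_theta : entropy (theta ρ p₁ p₂) = ∑ x₁, eta (p₁ x₁) + ∑ x₂, eta (p₂ x₂) +
    ∑ x₁, p₁ x₁ * ∑ x₂, p₂ x₂ * entropy (ρ x₁ x₂) := by
  rw [theta_eq_cqState, entropy_cqState _ fun x₁ => isDensity_cqState hp₂ (hρ x₁)]
  simp only [entropy_cqState p₂ (hρ _), mul_add, Finset.sum_add_distrib, ← Finset.sum_mul, hp₁.2]
  ring

include hρ hp₁ hp₂ in
lemma entropy_traceLast_theta : entropy (traceLast (theta ρ p₁ p₂)) =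
    ∑ x₁, eta (p₁ x₁) + ∑ x₂, eta (p₂ x₂) := by
  rw [traceLast_theta ρ hρ, entropy_cqState _ fun _ => isDensity_diagonal hp₂]
  simp only [entropy_diagonal, ← Finset.sum_mul, hp₁.2, one_mul]

include hρ hp₁ hp₂ in
lemma infoX₁GivenX₂_theta :
    infoX₁GivenX₂ (theta ρ p₁ p₂) = ∑ x₂, p₂ x₂ * holevo p₁ fun x₁ => ρ x₁ x₂ := by
  have h : ∀ x₂, IsDensity (avgState p₁ fun x₁ => ρ x₁ x₂) :=
    fun x₂ => isDensity_avgState hp₁ fun x₁ => hρ x₁ x₂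
  rw [infoX₁GivenX₂, entropy_traceLast_theta hρ hp₁ hp₂, entropy_theta hρ hp₁ hp₂,
    traceFst_theta, entropy_cqState _ h, traceSnd_cqState _ h, entropy_diagonal]
  simp only [holevo, mul_sub, Finset.sum_sub_distrib, Finset.mul_sum]
  rw [Finset.sum_comm (f := fun x₁ x₂ => p₁ x₁ * (p₂ x₂ * entropy (ρ x₁ x₂)))]
  simp only [mul_left_comm (p₁ _)]
  ring

include hρ hp₁ hp₂ in
lemma infoX₂GivenX₁_theta :
    infoX₂GivenX₁ (theta ρ p₁ p₂) = ∑ x₁, p₁ x₁ * holevo p₂ (ρ x₁) := by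
  have h : ∀ x₁, IsDensity (avgState p₂ (ρ x₁)) := fun x₁ => isDensity_avgState hp₂ (hρ x₁)
  rw [infoX₂GivenX₁, entropy_traceLast_theta hρ hp₁ hp₂, entropy_theta hρ hp₁ hp₂,
    traceMid_theta, entropy_cqState _ h, theta_eq_cqState,
    traceSnd_cqState _ fun x₁ => isDensity_cqState hp₂ (hρ x₁), entropy_diagonal]
  simp only [holevo, mul_sub, Finset.sum_sub_distrib]
  ring

end CornerPoints

/-! ### Tensor products of words of matrices. -/

section Tensor

variable {ι X d : Type*} [Fintype ι] [DecidableEq ι] [Fintype X] [Fintype d] [DecidableEq d]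

/-- The tensor product `⨂ᵢ A i`. -/
def tensorWord (A : ι → Matrix d d ℂ) : Matrix (ι → d) (ι → d) ℂ :=
  Matrix.of fun a b => ∏ i, A i (a i) (b i)

lemma tensorWord_mul (A B : ι → Matrix d d ℂ) :
    tensorWord A * tensorWord B = tensorWord fun i => A i * B i := by
  ext a b
  simp only [tensorWord, Matrix.mul_apply, Matrix.of_apply, ← Finset.prod_mul_distrib]
  rw [Fintype.prod_sum]

lemma tensorWord_conjTranspose (A : ι → Matrix d d ℂ) :
    (tensorWord A)ᴴ = tensorWord fun i => (A i)ᴴ := by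
  ext a b
  simp [tensorWord]

lemma tensorWord_diagonal (l : ι → d → ℂ) :
    tensorWord (fun i => Matrix.diagonal (l i)) = Matrix.diagonal fun a => ∏ i, l i (a i) := by
  ext a b
  by_cases h : a = b
  · subst h; simp [tensorWord]
  · obtain ⟨i, hi⟩ := Function.ne_iff.1 h
    rw [Matrix.diagonal_apply_ne _ h, tensorWord, Matrix.of_apply]
    exact Finset.prod_eq_zero (Finset.mem_univ i) (Matrix.diagonal_apply_ne _ hi)

lemma tensorWord_one : tensorWord (fun _ : ι => (1 : Matrix d d ℂ)) = 1 := by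
  simpa using tensorWord_diagonal (fun (_ : ι) (_ : d) => (1 : ℂ))

lemma tensorWord_specMat (W : ι → Matrix d d ℂ) (l : ι → d → ℝ) :
    tensorWord (fun i => specMat (W i) (l i)) =
      specMat (tensorWord W) fun a => ∏ i, l i (a i) := by
  simp only [specMat, ← tensorWord_mul, ← tensorWord_conjTranspose, tensorWord_diagonal]
  push_cast
  rfl

lemma tensorWord_unitary {W : ι → Matrix d d ℂ} (hW : ∀ i, (W i)ᴴ * W i = 1) :
    (tensorWord W)ᴴ * tensorWord W = 1 := by
  rw [tensorWord_conjTranspose, tensorWord_mul]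
  simp only [hW, tensorWord_one]

lemma isDensity_tensorWord {A : ι → Matrix d d ℂ} (hA : ∀ i, IsDensity (A i)) :
    IsDensity (tensorWord A) := by
  choose W l hW hA hl h1 using fun i => (hA i).exists_specMat
  have e : tensorWord A = specMat (tensorWord W) fun a => ∏ i, l i (a i) := by
    rw [← tensorWord_specMat]; congr 1; exact funext hA
  refine ⟨?_, ?_⟩
  · rw [e]
    exact Matrix.nonneg_iff_posSemidef.1
      (specMat_nonneg _ fun j => Finset.prod_nonneg fun i _ => hl _ _)
  · rw [e, trace_specMat (tensorWord_unitary hW), ← Fintype.prod_sum]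
    simp [h1]

/-- Averaging over an i.i.d. codeword acts letter by letter, so an undecoded codeword turns the
memoryless channel into another memoryless channel. -/
lemma avgState_tensorWord (p : X → ℝ) (ρ : ι → X → Matrix d d ℂ) :
    avgState (wordProb p) (fun x : ι → X => tensorWord fun i => ρ i (x i)) =
      tensorWord fun i => avgState p (ρ i) := by
  ext a b
  simp only [avgState_apply, tensorWord, Matrix.of_apply, wordProb]
  push_cast
  simp only [← Finset.prod_mul_distrib]
  rw [Fintype.prod_sum]

end Tensor

/-! ### Typical projectors. -/

section Typical

variable {A d : Type*} [Fintype A] [Fintype d] [DecidableEq d]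

lemma sum_word_prod {n : ℕ} (F : (Fin n → A) → (Fin n → d) → ℝ) :
    ∑ c : Fin n → A × d, F (fun i => (c i).1) (fun i => (c i).2) = ∑ a, ∑ j, F a j := by
  rw [← Fintype.sum_prod_type' F]
  exact Equiv.sum_comp (Equiv.arrowProdEquivProdArrow (Fin n) (fun _ => A) (fun _ => d))
    (fun aj : (Fin n → A) × (Fin n → d) => F aj.1 aj.2)

/-- Weakly typical projectors for words of states drawn independently from an ensemble. -/
theorem exists_typical_projector {q : A → ℝ} (hq : q ∈ stdSimplex ℝ A) {ω : A → Matrix d d ℂ}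
    (hω : ∀ a, IsDensity (ω a)) {δ : ℝ} (hδ : 0 < δ) :
    ∃ V : ℝ, 0 ≤ V ∧ ∀ n : ℕ, 0 < n → ∃ P : (Fin n → A) → Matrix (Fin n → d) (Fin n → d) ℂ,
      (∀ a, 0 ≤ P a) ∧ (∀ a, P a * P a = P a) ∧ (∀ a, P a ≤ 1) ∧
      (∀ a, (P a).trace.re ≤ 2 ^ (n * (∑ a, q a * entropy (ω a) + δ))) ∧
      (∀ a, P a * tensorWord (fun i => ω (a i)) * P a ≤
        ((2 : ℝ) ^ (-(n * (∑ a, q a * entropy (ω a) - δ)))) • 1) ∧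
      ∑ a, wordProb q a * (1 - (P a * tensorWord fun i => ω (a i)).trace.re) ≤ V / n := by
  classical
  choose W l hW hA hl h1 using fun a => (hω a).exists_specMat
  set H := ∑ a, q a * entropy (ω a) with hH
  -- The joint law of a letter and an eigenvalue label of its state. Quantum typicality becomes
  -- classical typicality for `g` under this law. Where the eigenvalue is 0, `g` takes the default
  -- value 0, but `Q` vanishes there.
  set Q : A × d → ℝ := fun x => q x.1 * l x.1 x.2 with hQ
  set g : A × d → ℝ := fun x => -Real.logb 2 (l x.1 x.2) with hg
  have hQs : Q ∈ stdSimplex ℝ (A × d) := by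
    refine ⟨fun x => mul_nonneg (hq.1 _) (hl _ _), ?_⟩
    simp only [hQ, Fintype.sum_prod_type, ← Finset.mul_sum, h1, mul_one, hq.2]
  have hμ : ∑ x, Q x * g x = H := by
    simp only [hQ, hg, hH, Fintype.sum_prod_type]
    refine Finset.sum_congr rfl fun a _ => ?_
    rw [hA a, entropy_specMat (hW a), Finset.mul_sum]
    exact Finset.sum_congr rfl fun j _ => by rw [eta]; ring
  refine ⟨(∑ x, Q x * (g x - ∑ y, Q y * g y) ^ 2) / δ ^ 2,
    div_nonneg (Finset.sum_nonneg fun x _ => mul_nonneg (hQs.1 x) (sq_nonneg _)) (sq_nonneg _),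
    fun n hn => ?_⟩
  set L : (Fin n → A) → (Fin n → d) → ℝ := fun a j => ∏ i, l (a i) (j i) with hL
  have hL0 : ∀ a j, 0 ≤ L a j := fun a j => Finset.prod_nonneg fun i _ => hl _ _
  -- The test is on the size of the eigenvalue itself, not on the word, so the trace and norm bounds
  -- hold for every `a`; only the mass bound is an average.
  set T : (Fin n → A) → (Fin n → d) → Prop := fun a j =>
    (2 : ℝ) ^ (-(n * (H + δ))) ≤ L a j ∧ L a j ≤ (2 : ℝ) ^ (-(n * (H - δ))) with hT
  set χ : (Fin n → A) → (Fin n → d) → ℝ := fun a j => if T a j then 1 else 0 with hχ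
  set Ω : (Fin n → A) → Matrix (Fin n → d) (Fin n → d) ℂ := fun a => tensorWord fun i => W (a i)
  have hΩ : ∀ a, (Ω a)ᴴ * Ω a = 1 := fun a => tensorWord_unitary fun i => hW (a i)
  have hσ : ∀ a : Fin n → A, (tensorWord fun i => ω (a i)) = specMat (Ω a) (L a) := fun a => by
    rw [← tensorWord_specMat (fun i => W (a i)) fun i => l (a i)]
    congr 1
    exact funext fun i => hA (a i)
  have hL1 : ∀ a, ∑ j, L a j = 1 := fun a => by
    rw [← Fintype.prod_sum]; simp [h1]
  refine ⟨fun a => specMat (Ω a) (χ a), fun a => specMat_nonneg _ fun j => ?_, fun a => ?_,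
    fun a => ?_, fun a => ?_, fun a => ?_, ?_⟩
  · simp only [hχ]; split_ifs <;> norm_num
  · rw [specMat_mul (hΩ a)]
    congr 1; ext j
    simp only [hχ]; split_ifs <;> norm_num
  · rw [← specMat_one (hΩ a)]
    refine specMat_mono _ fun j => ?_
    simp only [hχ]; split_ifs <;> norm_num
  · rw [trace_specMat (hΩ a), Complex.ofReal_re]
    have hb : (∑ j, χ a j) * (2 : ℝ) ^ (-(n * (H + δ))) ≤ 1 := by
      rw [← hL1 a, Finset.sum_mul]
      refine Finset.sum_le_sum fun j _ => ?_
      simp only [hχ]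
      split_ifs with h
      · rw [one_mul]; exact h.1
      · rw [zero_mul]; exact hL0 a j
    rw [Real.rpow_neg zero_le_two, ← div_eq_mul_inv, div_le_one (by positivity)] at hb
    exact hb
  · rw [hσ, specMat_mul (hΩ a), specMat_mul (hΩ a), ← specMat_one (hΩ a), specMat_smul]
    refine specMat_mono _ fun j => ?_
    simp only [hχ]
    split_ifs with h
    · simpa using h.2
    · simp only [zero_mul, mul_one]; positivity
  · have e : ∀ a, 1 - (specMat (Ω a) (χ a) * tensorWord fun i => ω (a i)).trace.re =
        ∑ j, L a j * (1 - χ a j) := fun a => by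
      rw [hσ, specMat_mul (hΩ a), trace_specMat (hΩ a), Complex.ofReal_re]
      simp only [mul_sub, mul_one, Finset.sum_sub_distrib, hL1, mul_comm (χ a _)]
    simp only [e, Finset.mul_sum]
    have hcheb := chebyshev hQs g hn hδ
    rw [hμ] at hcheb ⊢
    rw [div_div, mul_comm (δ ^ 2)]
    refine le_trans ?_ hcheb
    rw [← sum_word_prod fun a j => wordProb q a * (L a j * (1 - χ a j))]
    refine Finset.sum_le_sum fun c _ => ?_
    have hw : wordProb Q c = wordProb q (fun i => (c i).1) *
        L (fun i => (c i).1) (fun i => (c i).2) := by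
      simp only [wordProb, hQ, hL, Finset.prod_mul_distrib]
    rw [hw, mul_assoc]
    refine mul_le_mul_of_nonneg_left ?_ (wordProb_nonneg hq _)
    -- A zero eigenvalue carries no weight; this case is separate because the logarithm of the
    -- product needs nonzero factors.
    rcases (hL0 (fun i => (c i).1) (fun i => (c i).2)).eq_or_lt with h0 | h0
    · rw [← h0]; simp
    refine mul_le_mul_of_nonneg_left ?_ h0.le
    split_ifs with h
    · have hpos : ∀ i, l (c i).1 (c i).2 ≠ 0 := fun i hi =>
        h0.ne' (Finset.prod_eq_zero (Finset.mem_univ i) hi)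
      have hLg : L (fun i => (c i).1) (fun i => (c i).2) = (2 : ℝ) ^ (-∑ i, g (c i)) := by
        rw [eq_comm, ← Real.logb_eq_iff_rpow_eq two_pos (by norm_num) h0, hL,
          Real.logb_prod _ _ fun i _ => hpos i]
        simp [hg]
      rw [abs_le] at h
      have hTT : T (fun i => (c i).1) (fun i => (c i).2) := by
        simp only [hT, hLg]
        constructor <;> refine Real.rpow_le_rpow_of_exponent_le one_le_two ?_
        · linarith [h.2]
        · linarith [h.1]
      simp [hχ, hTT]
    · simp only [hχ]; split_ifs <;> norm_num

end Typical

/-! ### Square-root measurement and the packing bound. -/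

section Packing

variable {D : Type*} [Fintype D] [DecidableEq D]

lemma real_smul_one_nonneg {r : ℝ} (hr : 0 ≤ r) : (0 : Matrix D D ℂ) ≤ r • 1 :=
  smul_nonneg hr zero_le_one

/-- A regularized square-root measurement. -/
lemma exists_povm {M : Type*} [Fintype M] [DecidableEq M] [Nonempty M] {Y : M → Matrix D D ℂ}
    (hY : ∀ m, 0 ≤ Y m) (hY1 : ∀ m, Y m ≤ 1) {η : ℝ} (hη : 0 < η) :
    ∃ Λ : POVM M D, ∀ m, 1 - Λ.op m ≤
      (2 : ℝ) • (1 - Y m) + (4 : ℝ) • (∑ m' ∈ Finset.univ.erase m, Y m' + η • 1) := by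
  have hsum : 0 ≤ ∑ m, Y m := Finset.sum_nonneg fun m _ => hY m
  obtain ⟨G, hG, hGG⟩ := exists_sqrt (add_nonneg hsum (real_smul_one_nonneg (D := D) hη.le))
  -- The term η makes the sum invertible, so no pseudo-inverse is needed.
  have hpd : (∑ m, Y m + η • (1 : Matrix D D ℂ)).PosDef := by
    refine Matrix.PosDef.posSemidef_add (Matrix.nonneg_iff_posSemidef.1 hsum) ?_
    exact Matrix.PosDef.one.smul hη
  have hdet : IsUnit G.det := by
    have h := (Matrix.isUnit_iff_isUnit_det _).1 hpd.isUnit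
    rw [← hGG, Matrix.det_mul] at h
    exact isUnit_of_mul_isUnit_left h
  have h1 := Matrix.mul_nonsing_inv G hdet
  have h2 := Matrix.nonsing_inv_mul G hdet
  have hG' : (G⁻¹).IsHermitian := (isHermitian_of_nonneg hG).inv
  -- The leftover η G⁻² is given to an arbitrary outcome so that the operators sum to 1; this can
  -- only enlarge an outcome's operator.
  set m₀ : M := Classical.arbitrary M
  have hrest : 0 ≤ η • (G⁻¹ * G⁻¹) := by
    have := conj_nonneg (zero_le_one (α := Matrix D D ℂ)) hG'
    rw [mul_one] at this
    exact smul_nonneg hη.le this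
  have hite : ∀ m, 0 ≤ (if m = m₀ then η • (G⁻¹ * G⁻¹) else 0) := fun m => by
    split_ifs
    · exact hrest
    · exact le_rfl
  refine ⟨⟨fun m => G⁻¹ * Y m * G⁻¹ + if m = m₀ then η • (G⁻¹ * G⁻¹) else 0, fun m => ?_, ?_⟩,
    fun m => ?_⟩
  · exact Matrix.nonneg_iff_posSemidef.1 (add_nonneg (conj_nonneg (hY m) hG') (hite m))
  · rw [Finset.sum_add_distrib, Finset.sum_ite_eq' Finset.univ m₀, if_pos (Finset.mem_univ _),
      ← Finset.sum_mul, ← Finset.mul_sum]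
    have : G⁻¹ * (G * G) * G⁻¹ = 1 := by rw [← mul_assoc, h2, one_mul, h1]
    rw [hGG, mul_add, add_mul, mul_smul_comm, smul_mul_assoc, mul_one] at this
    exact this
  · have hT : 0 ≤ ∑ m' ∈ Finset.univ.erase m, Y m' + η • (1 : Matrix D D ℂ) :=
      add_nonneg (Finset.sum_nonneg fun m _ => hY m) (real_smul_one_nonneg hη.le)
    have hGG' : G * G = Y m + (∑ m' ∈ Finset.univ.erase m, Y m' + η • 1) := by
      rw [hGG, ← add_assoc, Finset.add_sum_erase _ _ (Finset.mem_univ m)]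
    refine le_trans ?_ (hayashi_nagaoka (hY m) (hY1 m) hT hG hGG' hG' h1 h2)
    exact sub_le_sub_left (le_add_of_nonneg_right (hite m)) _

variable {X : Type*} [Fintype X]

lemma sum_mul_trace_re (p : X → ℝ) (σ : X → Matrix D D ℂ) (A : Matrix D D ℂ) :
    ∑ x, p x * (A * σ x).trace.re = (A * avgState p σ).trace.re := by
  rw [avgState, Finset.mul_sum, Matrix.trace_sum, Complex.re_sum]
  refine Finset.sum_congr rfl fun x _ => ?_
  rw [mul_smul_comm, Matrix.trace_smul, smul_eq_mul, Complex.re_ofReal_mul]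

lemma sum_mul_one_sub_trace_re {p : X → ℝ} (hp : p ∈ stdSimplex ℝ X) (σ : X → Matrix D D ℂ)
    (A : Matrix D D ℂ) :
    ∑ x, p x * (1 - (A * σ x).trace.re) = 1 - (A * avgState p σ).trace.re := by
  simp only [mul_sub, mul_one, Finset.sum_sub_distrib, hp.2, sum_mul_trace_re]

lemma one_sub_trace_re_nonneg {A σ : Matrix D D ℂ} (hA : A ≤ 1) (hσ : IsDensity σ) :
    0 ≤ 1 - (A * σ).trace.re := by
  have h := trace_mul_re_mono hA hσ.nonneg
  rw [one_mul, hσ.2, Complex.one_re] at h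
  linarith

lemma conj_projector_le_one {P Q : Matrix D D ℂ} (hP : 0 ≤ P) (hPP : P * P = P) (hP1 : P ≤ 1)
    (hQ1 : Q ≤ 1) : P * Q * P ≤ 1 := by
  refine (conj_le_conj hQ1 (isHermitian_of_nonneg hP)).trans ?_
  rwa [mul_one, hPP]

/-- Sequential detection by two projectors. -/
lemma one_sub_trace_conj_projector_le {P Q σ : Matrix D D ℂ} (hP : 0 ≤ P) (hPP : P * P = P)
    (hP1 : P ≤ 1) (hQ : 0 ≤ Q) (hQQ : Q * Q = Q) (hQ1 : Q ≤ 1) (hσ : IsDensity σ) :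
    1 - (P * Q * P * σ).trace.re ≤ 2 * (√(1 - (P * σ).trace.re) + √(1 - (Q * σ).trace.re)) := by
  have htr : σ.trace.re = 1 := by rw [hσ.2, Complex.one_re]
  -- Two projectors are a three-step measurement whose last step is trivial.
  have h := successive_bound (A₃ := 1) hP (hPP.trans_le hP1) hQ (hQQ.trans_le hQ1) zero_le_one
    (mul_one _).le hσ.nonneg htr
  rw [hPP, hQQ, one_mul, one_mul, one_mul, htr, sub_self, Real.sqrt_zero, add_zero] at h
  have e : (Q * (P * σ * P) * Q).trace = (P * Q * P * σ).trace := by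
    rw [Matrix.trace_mul_comm, ← mul_assoc, hQQ, ← mul_assoc, Matrix.trace_mul_comm]
    simp only [mul_assoc]
  rwa [e] at h

/-- The packing lemma for a random codebook, in terms of code and codeword projectors. -/
lemma packing_oneshot {p : X → ℝ} (hp : p ∈ stdSimplex ℝ X) {σ : X → Matrix D D ℂ}
    (hσ : ∀ x, IsDensity (σ x)) {P : Matrix D D ℂ} (hP : 0 ≤ P) (hPP : P * P = P) (hP1 : P ≤ 1)
    {Q : X → Matrix D D ℂ} (hQ : ∀ x, 0 ≤ Q x) (hQQ : ∀ x, Q x * Q x = Q x) (hQ1 : ∀ x, Q x ≤ 1)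
    {c K : ℝ} (hc : 0 ≤ c) (hcP : P * avgState p σ * P ≤ c • 1) (hK : ∀ x, (Q x).trace.re ≤ K)
    {η : ℝ} (hη : 0 < η) (M : ℕ) [NeZero M] :
    ∃ Λ : (Fin M → X) → POVM (Fin M) D, ∀ m,
      ∑ cb, wordProb p cb * (1 - ((Λ cb).op m * σ (cb m)).trace.re) ≤
        4 * (√(∑ x, p x * (1 - (P * σ x).trace.re)) +
          √(∑ x, p x * (1 - (Q x * σ x).trace.re))) + 4 * (((M : ℝ) - 1) * (c * K) + η) := by
  have hPh := isHermitian_of_nonneg hP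
  choose Λ hΛ using fun cb : Fin M → X => exists_povm (Y := fun m => P * Q (cb m) * P)
    (fun m => conj_nonneg (hQ _) hPh) (fun m => conj_projector_le_one hP hPP hP1 (hQ1 _)) hη
  refine ⟨Λ, fun m => ?_⟩
  -- One factor 2 comes from Hayashi–Nagaoka, the other from detection by P and then Q.
  set e : X → ℝ := fun x => 2 * (2 * (√(1 - (P * σ x).trace.re) + √(1 - (Q x * σ x).trace.re)))
  have hpt : ∀ cb : Fin M → X, 1 - ((Λ cb).op m * σ (cb m)).trace.re ≤
      e (cb m) + 4 * (∑ m' ∈ Finset.univ.erase m,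
        (P * Q (cb m') * P * σ (cb m)).trace.re + η) := by
    intro cb
    have h := trace_mul_re_mono (hΛ cb m) (hσ (cb m)).nonneg
    rw [sub_mul, one_mul, Matrix.trace_sub, Complex.sub_re, (hσ _).2, Complex.one_re] at h
    refine h.trans ?_
    have hs := one_sub_trace_conj_projector_le hP hPP hP1 (hQ (cb m)) (hQQ _) (hQ1 _) (hσ (cb m))
    simp only [add_mul, smul_mul_assoc, sub_mul, one_mul, Matrix.trace_add, Matrix.trace_smul,
      Complex.add_re, Complex.smul_re, Matrix.trace_sub, Complex.sub_re, (hσ _).2, Complex.one_re,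
      Finset.sum_mul, Matrix.trace_sum, Complex.re_sum, smul_eq_mul, mul_one]
    linarith
  have hcross : ∀ m' ∈ Finset.univ.erase m,
      ∑ cb : Fin M → X, wordProb p cb * (P * Q (cb m') * P * σ (cb m)).trace.re ≤ c * K := by
    intro m' hm'
    -- A wrong codeword is independent of the sent one, so the sent state can be averaged first;
    -- then P σ̄ P ≤ c and tr Q ≤ K bound the overlap.
    rw [sum_wordProb_apply₂ hp (Finset.ne_of_mem_erase hm')
      (fun y x => (P * Q y * P * σ x).trace.re)]
    simp only [sum_mul_trace_re]
    have hb : ∀ y, (P * Q y * P * avgState p σ).trace.re ≤ c * K := fun y => by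
      have e1 : (P * Q y * P * avgState p σ).trace = (P * avgState p σ * P * Q y).trace := by
        have : P * Q y * P * avgState p σ = (P * Q y) * (P * avgState p σ) := by noncomm_ring
        rw [this, Matrix.trace_mul_comm]
        simp only [mul_assoc]
      rw [e1]
      refine (trace_mul_re_mono hcP (hQ y)).trans ?_
      rw [smul_mul_assoc, one_mul, Matrix.trace_smul, Complex.smul_re, smul_eq_mul]
      exact mul_le_mul_of_nonneg_left (hK y) hc
    calc _ ≤ ∑ y, p y * (c * K) :=
          Finset.sum_le_sum fun y _ => mul_le_mul_of_nonneg_left (hb y) (hp.1 y)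
      _ = c * K := by rw [← Finset.sum_mul, hp.2, one_mul]
  have he : ∑ cb : Fin M → X, wordProb p cb * e (cb m) ≤
      4 * (√(∑ x, p x * (1 - (P * σ x).trace.re)) +
          √(∑ x, p x * (1 - (Q x * σ x).trace.re))) := by
    rw [sum_wordProb_apply hp m e]
    have h1 := sum_mul_sqrt_le hp fun x => one_sub_trace_re_nonneg hP1 (hσ x)
    have h2 := sum_mul_sqrt_le hp fun x => one_sub_trace_re_nonneg (hQ1 x) (hσ x)
    have : ∑ x, p x * e x = 4 * (∑ x, p x * √(1 - (P * σ x).trace.re) +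
        ∑ x, p x * √(1 - (Q x * σ x).trace.re)) := by
      rw [← Finset.sum_add_distrib, Finset.mul_sum]
      exact Finset.sum_congr rfl fun x _ => by simp only [e]; ring
    rw [this]
    linarith
  calc _ ≤ ∑ cb : Fin M → X, wordProb p cb * (e (cb m) + 4 * (∑ m' ∈ Finset.univ.erase m,
        (P * Q (cb m') * P * σ (cb m)).trace.re + η)) :=
        Finset.sum_le_sum fun cb _ => mul_le_mul_of_nonneg_left (hpt cb) (wordProb_nonneg hp cb)
    _ = ∑ cb : Fin M → X, wordProb p cb * e (cb m) +
        4 * (∑ m' ∈ Finset.univ.erase m, ∑ cb : Fin M → X,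
          wordProb p cb * (P * Q (cb m') * P * σ (cb m)).trace.re + η) := by
      rw [Finset.sum_comm]
      have h1 : η = ∑ cb : Fin M → X, wordProb p cb * η := by
        rw [← Finset.sum_mul, sum_wordProb hp, one_mul]
      nth_rw 2 [h1]
      rw [← Finset.sum_add_distrib, Finset.mul_sum, ← Finset.sum_add_distrib]
      refine Finset.sum_congr rfl fun cb _ => ?_
      rw [← Finset.mul_sum]
      ring
    _ ≤ _ := by
      have h3 := Finset.sum_le_sum hcross
      rw [Finset.sum_const, Finset.card_erase_of_mem (Finset.mem_univ m), Finset.card_univ,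
        Fintype.card_fin, nsmul_eq_mul, Nat.cast_pred (Nat.pos_of_ne_zero (NeZero.ne M))] at h3
      linarith

end Packing

/-! ### Random coding with a state known to the receiver. -/

section SideInformation

open Filter Topology

variable {S X d : Type*} [Fintype S] [Fintype X] [Fintype d] [DecidableEq d]

lemma prod_mem_stdSimplex {pS : S → ℝ} (hS : pS ∈ stdSimplex ℝ S) {pX : X → ℝ}
    (hX : pX ∈ stdSimplex ℝ X) : (fun x : S × X => pS x.1 * pX x.2) ∈ stdSimplex ℝ (S × X) := by
  refine ⟨fun x => mul_nonneg (hS.1 _) (hX.1 _), ?_⟩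
  simp only [Fintype.sum_prod_type, ← Finset.mul_sum, hX.2, mul_one, hS.2]

lemma wordProb_prod {n : ℕ} (pS : S → ℝ) (pX : X → ℝ) (c : Fin n → S × X) :
    wordProb (fun x : S × X => pS x.1 * pX x.2) c =
      wordProb pS (fun i => (c i).1) * wordProb pX (fun i => (c i).2) := by
  simp only [wordProb, Finset.prod_mul_distrib]

lemma avgState_output {n : ℕ} (p : X → ℝ) (ρ : S → X → Matrix d d ℂ) (s : Fin n → S) :
    avgState (wordProb p) (fun x => output ρ s x) = tensorWord fun i => avgState p (ρ (s i)) :=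
  avgState_tensorWord p fun i => ρ (s i)

/-- Random coding for a classical-quantum channel whose receiver knows the i.i.d. state `s`. -/
theorem exists_decoder_sideInformation {ρ : S → X → Matrix d d ℂ}
    (hρ : ∀ s x, IsDensity (ρ s x)) {pS : S → ℝ} (hS : pS ∈ stdSimplex ℝ S) {pX : X → ℝ}
    (hX : pX ∈ stdSimplex ℝ X) {R : ℝ} (hR : R < ∑ s, pS s * holevo pX (ρ s)) {ε : ℝ}
    (hε : 0 < ε) :
    ∃ N : ℕ, ∀ n ≥ N, ∀ M : ℕ, 0 < M → (M : ℝ) - 1 ≤ 2 ^ (n * R) →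
      ∃ Λ : (Fin n → S) → (Fin M → Fin n → X) → POVM (Fin M) (Fin n → d), ∀ m,
        ∑ s, wordProb pS s * ∑ cb, codebookProb pX cb *
          (1 - ((Λ s cb).op m * output ρ s (cb m)).trace.re) ≤ ε := by
  set I := ∑ s, pS s * holevo pX (ρ s) with hI
  -- Each typical projector costs one δ in the exponent, and the third leaves the decay 2^{-nδ}.
  set δ := (I - R) / 3 with hδ
  have hδ0 : 0 < δ := by rw [hδ]; linarith
  have hav : ∀ s, IsDensity (avgState pX (ρ s)) := fun s => isDensity_avgState hX (hρ s)
  obtain ⟨V₁, hV₁, h₁⟩ := exists_typical_projector hS hav hδ0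
  obtain ⟨V₂, hV₂, h₂⟩ := exists_typical_projector (prod_mem_stdSimplex hS hX)
    (ω := fun sx => ρ sx.1 sx.2) (fun sx => hρ sx.1 sx.2) hδ0
  set H₁ := ∑ s, pS s * entropy (avgState pX (ρ s)) with hH₁
  set H₂ := ∑ sx : S × X, pS sx.1 * pX sx.2 * entropy (ρ sx.1 sx.2) with hH₂
  have hIH : I = H₁ - H₂ := by
    simp only [hI, hH₁, hH₂, holevo, mul_sub, Finset.sum_sub_distrib, Fintype.sum_prod_type,
      Finset.mul_sum, mul_assoc]
  -- The regularization ε/8 survives in the limit as ε/2, below ε.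
  have hlim : Tendsto (fun n : ℕ => 4 * (√(V₁ / n) + √(V₂ / n)) +
      4 * (((2 : ℝ) ^ (-δ)) ^ n + ε / 8)) atTop (𝓝 (4 * (√0 + √0) + 4 * (0 + ε / 8))) := by
    have hV : ∀ V : ℝ, Tendsto (fun n : ℕ => √(V / n)) atTop (𝓝 √0) := fun V =>
      (Real.continuous_sqrt.tendsto 0).comp (tendsto_const_div_atTop_nhds_zero_nat V)
    have hp : Tendsto (fun n : ℕ => ((2 : ℝ) ^ (-δ)) ^ n) atTop (𝓝 0) :=
      tendsto_pow_atTop_nhds_zero_of_lt_one (by positivity)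
        (Real.rpow_lt_one_of_one_lt_of_neg one_lt_two (by linarith))
    exact (((hV V₁).add (hV V₂)).const_mul 4).add ((hp.add_const _).const_mul 4)
  have hev := hlim.eventually_lt_const (u := ε) (by rw [Real.sqrt_zero]; linarith)
  obtain ⟨N, hN⟩ := eventually_atTop.1 (hev.and (eventually_gt_atTop 0))
  refine ⟨N, fun n hn M hM hMR => ?_⟩
  obtain ⟨hlt, hn0⟩ := hN n hn
  obtain ⟨P, hP, hPP, hP1, -, hPσ, hPe⟩ := h₁ n hn0
  obtain ⟨Q, hQ, hQQ, hQ1, hQt, -, hQe⟩ := h₂ n hn0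
  have : NeZero M := ⟨hM.ne'⟩
  have hout : ∀ (s : Fin n → S) (x : Fin n → X), IsDensity (output ρ s x) := fun s x =>
    isDensity_tensorWord fun i => hρ _ _
  choose Λ hΛ using fun s : Fin n → S => packing_oneshot (wordProb_mem_stdSimplex (ι := Fin n) hX)
    (σ := fun x => output ρ s x) (fun x => hout s x) (hP s) (hPP s) (hP1 s)
    (Q := fun x => Q fun i => (s i, x i)) (fun x => hQ _) (fun x => hQQ _) (fun x => hQ1 _)
    (c := (2 : ℝ) ^ (-(n * (H₁ - δ)))) (by positivity)
    (by rw [avgState_output]; exact hPσ s) (fun x => hQt _) (η := ε / 8) (by linarith) M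
  refine ⟨Λ, fun m => ?_⟩
  set e₁ : (Fin n → S) → ℝ :=
    fun s => ∑ x, wordProb pX x * (1 - (P s * output ρ s x).trace.re) with he₁
  set e₂ : (Fin n → S) → ℝ :=
    fun s => ∑ x, wordProb pX x * (1 - (Q (fun i => (s i, x i)) * output ρ s x).trace.re) with he₂
  have he₁0 : ∀ s, 0 ≤ e₁ s := fun s => Finset.sum_nonneg fun x _ =>
    mul_nonneg (wordProb_nonneg hX x) (one_sub_trace_re_nonneg (hP1 s) (hout s x))
  have he₂0 : ∀ s, 0 ≤ e₂ s := fun s => Finset.sum_nonneg fun x _ =>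
    mul_nonneg (wordProb_nonneg hX x) (one_sub_trace_re_nonneg (hQ1 _) (hout s x))
  have hE₁ : ∑ s, wordProb pS s * e₁ s ≤ V₁ / n := by
    refine le_trans (le_of_eq (Finset.sum_congr rfl fun s _ => ?_)) hPe
    rw [he₁]
    dsimp only
    rw [sum_mul_one_sub_trace_re (wordProb_mem_stdSimplex hX) (fun x => output ρ s x),
      avgState_output]
  have hE₂ : ∑ s, wordProb pS s * e₂ s ≤ V₂ / n := by
    refine le_trans (le_of_eq ?_) hQe
    simp only [wordProb_prod]
    rw [← Equiv.sum_comp (Equiv.arrowProdEquivProdArrow (Fin n) (fun _ => S) (fun _ => X)).symm,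
      Fintype.sum_prod_type]
    refine Finset.sum_congr rfl fun s _ => ?_
    rw [he₂, Finset.mul_sum]
    refine Finset.sum_congr rfl fun x _ => ?_
    rw [← mul_assoc]
    rfl
  have hwS := wordProb_mem_stdSimplex (ι := Fin n) hS
  have hJ₁ := (sum_mul_sqrt_le hwS he₁0).trans (Real.sqrt_le_sqrt hE₁)
  have hJ₂ := (sum_mul_sqrt_le hwS he₂0).trans (Real.sqrt_le_sqrt hE₂)
  have hMcK : ((M : ℝ) - 1) * ((2 : ℝ) ^ (-(n * (H₁ - δ))) * 2 ^ (n * (H₂ + δ))) ≤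
      ((2 : ℝ) ^ (-δ)) ^ n := by
    refine (mul_le_mul_of_nonneg_right hMR (by positivity)).trans (le_of_eq ?_)
    rw [← Real.rpow_add two_pos, ← Real.rpow_add two_pos, ← Real.rpow_natCast,
      ← Real.rpow_mul zero_le_two]
    congr 1
    have : R = H₁ - H₂ - 3 * δ := by rw [hδ, ← hIH]; ring
    rw [this]; ring
  set B := 4 * (((M : ℝ) - 1) * ((2 : ℝ) ^ (-(n * (H₁ - δ))) * 2 ^ (n * (H₂ + δ))) + ε / 8) with hB
  calc _ ≤ ∑ s, wordProb pS s * (4 * (√(e₁ s) + √(e₂ s)) + B) :=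
        Finset.sum_le_sum fun s _ => mul_le_mul_of_nonneg_left (hΛ s m) (wordProb_nonneg hS s)
    _ = 4 * (∑ s, wordProb pS s * √(e₁ s) + ∑ s, wordProb pS s * √(e₂ s)) + B := by
      have h1 : B = ∑ s : Fin n → S, wordProb pS s * B := by
        rw [← Finset.sum_mul, sum_wordProb hS, one_mul]
      nth_rw 2 [h1]
      rw [← Finset.sum_add_distrib, Finset.mul_sum, ← Finset.sum_add_distrib]
      exact Finset.sum_congr rfl fun s _ => by ring
    _ ≤ 4 * (√(V₁ / n) + √(V₂ / n)) + 4 * (((2 : ℝ) ^ (-δ)) ^ n + ε / 8) := by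
      rw [hB]; linarith
    _ ≤ ε := hlt.le

end SideInformation

/-! ### Combining the three decoders. -/

section Successive

variable {X₁ X₂ U V d : Type*} [Fintype X₁] [Fintype U] [Fintype V] [Fintype d] [DecidableEq d]

lemma POVM.op_nonneg {M D : Type*} [Fintype M] [Fintype D] [DecidableEq D] (Λ : POVM M D)
    (m : M) : 0 ≤ Λ.op m :=
  Matrix.nonneg_iff_posSemidef.2 (Λ.posSemidef m)

lemma POVM.op_le_one {M D : Type*} [Fintype M] [Fintype D] [DecidableEq D] (Λ : POVM M D)
    (m : M) : Λ.op m ≤ 1 := by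
  rw [← Λ.sum_eq_one]
  exact Finset.single_le_sum (fun m _ => Λ.op_nonneg m) (Finset.mem_univ m)

/-- The error of a successive decoder in terms of the errors of its measurements on the
undisturbed state. -/
lemma SuccessiveDecoder.one_sub_prob_le {Mu M₁ Mv D : Type*} [Fintype Mu] [Fintype M₁]
    [Fintype Mv] [Fintype D] [DecidableEq D] (Λ : SuccessiveDecoder Mu M₁ Mv D)
    (mu : Mu) (m₁ : M₁) (mv : Mv) {σ : Matrix D D ℂ} (hσ : IsDensity σ) :
    1 - Λ.prob mu m₁ mv σ ≤
      2 * (√(1 - (Λ.decU.op mu * σ).trace.re) + √(1 - ((Λ.dec1 mu).op m₁ * σ).trace.re) +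
        √(1 - ((Λ.decV mu m₁).op mv * σ).trace.re)) := by
  have s₁ := CFC.sqrt_mul_sqrt_self _ (Λ.decU.op_nonneg mu)
  have s₂ := CFC.sqrt_mul_sqrt_self _ ((Λ.dec1 mu).op_nonneg m₁)
  have s₃ := CFC.sqrt_mul_sqrt_self _ ((Λ.decV mu m₁).op_nonneg mv)
  have h := successive_bound (CFC.sqrt_nonneg (Λ.decU.op mu))
    (s₁.trans_le (Λ.decU.op_le_one mu)) (CFC.sqrt_nonneg ((Λ.dec1 mu).op m₁))
    (s₂.trans_le ((Λ.dec1 mu).op_le_one m₁)) (CFC.sqrt_nonneg ((Λ.decV mu m₁).op mv))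
    (s₃.trans_le ((Λ.decV mu m₁).op_le_one mv)) hσ.nonneg (by rw [hσ.2, Complex.one_re])
  rw [s₁, s₂, s₃] at h
  exact h

variable {ρ : X₁ → X₂ → Matrix d d ℂ} {f : U → V → X₂} {p₁ : X₁ → ℝ} {pU : U → ℝ} {pV : V → ℝ}

lemma codebookProb_mem_stdSimplex {X M : Type*} [Fintype X] [Fintype M] [DecidableEq M] {n : ℕ}
    {p : X → ℝ} (hp : p ∈ stdSimplex ℝ X) :
    (codebookProb p : (M → Fin n → X) → ℝ) ∈ stdSimplex ℝ (M → Fin n → X) :=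
  wordProb_mem_stdSimplex (wordProb_mem_stdSimplex hp)

lemma sum_codebookProb_apply {X M : Type*} [Fintype X] [Fintype M] [DecidableEq M] {n : ℕ}
    {p : X → ℝ} (hp : p ∈ stdSimplex ℝ X) (m : M) (g : (Fin n → X) → ℝ) :
    ∑ c, codebookProb p c * g (c m) = ∑ x, wordProb p x * g x :=
  sum_wordProb_apply (wordProb_mem_stdSimplex hp) m g

/-- Averaging the second sender's `V`-codeword. -/
lemma sum_codebookProb_output {Mv : Type*} [Fintype Mv] [DecidableEq Mv] {n : ℕ}
    (hV : pV ∈ stdSimplex ℝ V) (mv : Mv) (x : Fin n → X₁) (u : Fin n → U)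
    (A : Matrix (Fin n → d) (Fin n → d) ℂ) :
    ∑ cv : Mv → Fin n → V, codebookProb pV cv *
        (1 - (A * output ρ x fun i => f (u i) (cv mv i)).trace.re) =
      1 - (A * output (fun u x => avgState pV fun v => ρ x (f u v)) u x).trace.re := by
  rw [sum_codebookProb_apply hV mv fun v =>
    1 - (A * output ρ x fun i => f (u i) (v i)).trace.re]
  rw [sum_mul_one_sub_trace_re (wordProb_mem_stdSimplex hV)
    (fun v : Fin n → V => output ρ x fun i => f (u i) (v i))]
  rw [show avgState (wordProb pV) (fun v : Fin n → V => output ρ x fun i => f (u i) (v i)) =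
    output (fun u x => avgState pV fun v => ρ x (f u v)) u x from
    avgState_tensorWord pV fun i v => ρ (x i) (f (u i) v)]

lemma expectedError_eq {n : ℕ} {M₁ Mu Mv : Type*} [Fintype M₁] [Fintype Mu] [Fintype Mv]
    [DecidableEq M₁] [DecidableEq Mu] [DecidableEq Mv]
    (Λ : (M₁ → Fin n → X₁) → (Mu → Fin n → U) → (Mv → Fin n → V) →
      SuccessiveDecoder Mu M₁ Mv (Fin n → d)) :
    expectedError ρ f p₁ pU pV Λ = ∑ z : (M₁ → Fin n → X₁) × (Mu → Fin n → U) × (Mv → Fin n → V),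
      codebookProb p₁ z.1 * (codebookProb pU z.2.1 * codebookProb pV z.2.2) *
        avgError ρ f z.1 z.2.1 z.2.2 (Λ z.1 z.2.1 z.2.2) := by
  simp only [expectedError, Fintype.sum_prod_type, mul_assoc]

/-- Random coding with successive decoding, from the three random codes with side information. -/
theorem expectedError_le {n : ℕ} {M₁ Mu Mv : ℕ} [NeZero M₁] [NeZero Mu] [NeZero Mv]
    (hρ : ∀ x₁ x₂, IsDensity (ρ x₁ x₂)) (h₁ : p₁ ∈ stdSimplex ℝ X₁) (hU : pU ∈ stdSimplex ℝ U)
    (hV : pV ∈ stdSimplex ℝ V) {ε : ℝ}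
    {ΛU : (Fin n → Unit) → (Fin Mu → Fin n → U) → POVM (Fin Mu) (Fin n → d)}
    (hΛU : ∀ m, ∑ s, wordProb (fun _ : Unit => 1) s * ∑ cb, codebookProb pU cb *
      (1 - ((ΛU s cb).op m * output (fun (_ : Unit) u => avgState p₁ fun x =>
        avgState pV fun v => ρ x (f u v)) s (cb m)).trace.re) ≤ ε)
    {Λ₁ : (Fin n → U) → (Fin M₁ → Fin n → X₁) → POVM (Fin M₁) (Fin n → d)}
    (hΛ₁ : ∀ m, ∑ s, wordProb pU s * ∑ cb, codebookProb p₁ cb *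
      (1 - ((Λ₁ s cb).op m * output (fun u x =>
        avgState pV fun v => ρ x (f u v)) s (cb m)).trace.re) ≤ ε)
    {ΛV : (Fin n → U × X₁) → (Fin Mv → Fin n → V) → POVM (Fin Mv) (Fin n → d)}
    (hΛV : ∀ m, ∑ s, wordProb (fun s : U × X₁ => pU s.1 * p₁ s.2) s * ∑ cb, codebookProb pV cb *
      (1 - ((ΛV s cb).op m * output (fun (s : U × X₁) v => ρ s.2 (f s.1 v)) s (cb m)).trace.re) ≤
        ε) :
    expectedError ρ f p₁ pU pV (fun cx cu cv =>
      (⟨ΛU (fun _ => ()) cu, fun mu => Λ₁ (cu mu) cx, fun mu m₁ =>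
        ΛV (fun i => (cu mu i, cx m₁ i)) cv⟩ :
          SuccessiveDecoder (Fin Mu) (Fin M₁) (Fin Mv) (Fin n → d))) ≤ 6 * √ε := by
  set w : (Fin M₁ → Fin n → X₁) × (Fin Mu → Fin n → U) × (Fin Mv → Fin n → V) → ℝ :=
    fun z => codebookProb p₁ z.1 * (codebookProb pU z.2.1 * codebookProb pV z.2.2) with hwdef
  have hw : w ∈ stdSimplex ℝ _ := prod_mem_stdSimplex (codebookProb_mem_stdSimplex h₁)
    (prod_mem_stdSimplex (codebookProb_mem_stdSimplex hU) (codebookProb_mem_stdSimplex hV))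
  have hout : ∀ (x : Fin n → X₁) (u : Fin n → U) (v : Fin n → V),
      IsDensity (output ρ x fun i => f (u i) (v i)) := fun x u v =>
    isDensity_tensorWord fun i => hρ _ _
  have hsplit : ∀ F : (Fin M₁ → Fin n → X₁) → (Fin Mu → Fin n → U) → (Fin Mv → Fin n → V) → ℝ,
      ∑ z, w z * F z.1 z.2.1 z.2.2 = ∑ cu, codebookProb pU cu * ∑ cx, codebookProb p₁ cx *
        ∑ cv, codebookProb pV cv * F cx cu cv := fun F => by
    simp only [Fintype.sum_prod_type, hwdef, Finset.mul_sum]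
    rw [Finset.sum_comm]
    exact Finset.sum_congr rfl fun _ _ => Finset.sum_congr rfl fun _ _ =>
      Finset.sum_congr rfl fun _ _ => by ring
  have hjensen : ∀ e : (Fin M₁ → Fin n → X₁) × (Fin Mu → Fin n → U) × (Fin Mv → Fin n → V) → ℝ,
      (∀ z, 0 ≤ e z) → ∑ z, w z * e z ≤ ε → ∑ z, w z * √(e z) ≤ √ε := fun e he h =>
    (sum_mul_sqrt_le hw he).trans (Real.sqrt_le_sqrt h)
  have hlin : ∀ a b c : (Fin M₁ → Fin n → X₁) × (Fin Mu → Fin n → U) × (Fin Mv → Fin n → V) → ℝ,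
      ∑ z, w z * (2 * (a z + b z + c z)) =
        2 * (∑ z, w z * a z + ∑ z, w z * b z + ∑ z, w z * c z) := fun a b c => by
    rw [← Finset.sum_add_distrib, ← Finset.sum_add_distrib, Finset.mul_sum]
    exact Finset.sum_congr rfl fun _ _ => by ring
  have hbound : ∀ m₁ mu mv, ∑ z, w z * (1 - SuccessiveDecoder.prob
      (⟨ΛU (fun _ => ()) z.2.1, fun mu => Λ₁ (z.2.1 mu) z.1, fun mu m₁ =>
        ΛV (fun i => (z.2.1 mu i, z.1 m₁ i)) z.2.2⟩ :
          SuccessiveDecoder (Fin Mu) (Fin M₁) (Fin Mv) (Fin n → d)) mu m₁ mv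
      (output ρ (z.1 m₁) fun i => f (z.2.1 mu i) (z.2.2 mv i))) ≤ 6 * √ε := by
    intro m₁ mu mv
    -- The first measurement ignores `cx` and `cv`, so averaging over them produces the effective
    -- channel from U to B.
    have b₁ := hjensen (fun z => 1 - ((ΛU (fun _ => ()) z.2.1).op mu *
        output ρ (z.1 m₁) fun i => f (z.2.1 mu i) (z.2.2 mv i)).trace.re)
      (fun z => one_sub_trace_re_nonneg (POVM.op_le_one _ _) (hout _ _ _)) (by
        rw [hsplit fun cx cu cv => 1 - ((ΛU (fun _ => ()) cu).op mu *
          output ρ (cx m₁) fun i => f (cu mu i) (cv mv i)).trace.re]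
        refine le_trans (le_of_eq ?_) (hΛU mu)
        rw [Fintype.sum_unique (ι := Fin n → Unit), show wordProb (fun _ : Unit => (1 : ℝ))
          (default : Fin n → Unit) = 1 by simp [wordProb], one_mul]
        refine Finset.sum_congr rfl fun cu _ => congrArg _ ?_
        simp only [sum_codebookProb_output hV]
        rw [sum_codebookProb_apply h₁ m₁ fun x => 1 - ((ΛU (fun _ => ()) cu).op mu *
          output (fun u x => avgState pV fun v => ρ x (f u v)) (cu mu) x).trace.re,
          sum_mul_one_sub_trace_re (wordProb_mem_stdSimplex h₁) (fun x =>
            output (fun u x => avgState pV fun v => ρ x (f u v)) (cu mu) x), avgState_output]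
        rfl)
    -- Only `cv` is averaged out here. The correct codeword `cu mu` serves as the i.i.d. state,
    -- since success so far is what the gentle-measurement bound tests.
    have b₂ := hjensen (fun z => 1 - ((Λ₁ (z.2.1 mu) z.1).op m₁ *
        output ρ (z.1 m₁) fun i => f (z.2.1 mu i) (z.2.2 mv i)).trace.re)
      (fun z => one_sub_trace_re_nonneg (POVM.op_le_one _ _) (hout _ _ _)) (by
        rw [hsplit fun cx cu cv => 1 - ((Λ₁ (cu mu) cx).op m₁ *
          output ρ (cx m₁) fun i => f (cu mu i) (cv mv i)).trace.re]
        refine le_trans (le_of_eq ?_) (hΛ₁ m₁)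
        simp only [sum_codebookProb_output hV]
        exact sum_codebookProb_apply hU mu fun u => ∑ cx, codebookProb p₁ cx *
          (1 - ((Λ₁ u cx).op m₁ * output (fun u x =>
            avgState pV fun v => ρ x (f u v)) u (cx m₁)).trace.re))
    -- Nothing is averaged out of the channel: the pair of sent codewords is the i.i.d. state.
    have b₃ := hjensen (fun z => 1 - ((ΛV (fun i => (z.2.1 mu i, z.1 m₁ i)) z.2.2).op mv *
        output ρ (z.1 m₁) fun i => f (z.2.1 mu i) (z.2.2 mv i)).trace.re)
      (fun z => one_sub_trace_re_nonneg (POVM.op_le_one _ _) (hout _ _ _)) (by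
        rw [hsplit fun cx cu cv => 1 - ((ΛV (fun i => (cu mu i, cx m₁ i)) cv).op mv *
          output ρ (cx m₁) fun i => f (cu mu i) (cv mv i)).trace.re]
        refine le_trans (le_of_eq ?_) (hΛV mv)
        set G : (Fin n → U) → (Fin n → X₁) → ℝ := fun u x => ∑ cv, codebookProb pV cv *
          (1 - ((ΛV (fun i => (u i, x i)) cv).op mv *
            output ρ x fun i => f (u i) (cv mv i)).trace.re) with hG
        have e1 : ∀ cu : Fin Mu → Fin n → U, ∑ cx : Fin M₁ → Fin n → X₁,
            codebookProb p₁ cx * G (cu mu) (cx m₁) = ∑ x, wordProb p₁ x * G (cu mu) x :=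
          fun cu => sum_codebookProb_apply h₁ m₁ fun x => G (cu mu) x
        calc _ = ∑ cu : Fin Mu → Fin n → U, codebookProb pU cu *
              ∑ x, wordProb p₁ x * G (cu mu) x :=
              Finset.sum_congr rfl fun cu _ => congrArg _ (e1 cu)
          _ = ∑ u, wordProb pU u * ∑ x, wordProb p₁ x * G u x :=
              sum_codebookProb_apply hU mu fun u => ∑ x, wordProb p₁ x * G u x
          _ = _ := by
            simp only [wordProb_prod]
            rw [← Equiv.sum_comp (Equiv.arrowProdEquivProdArrow (Fin n) (fun _ => U)
              (fun _ => X₁)).symm, Fintype.sum_prod_type]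
            refine Finset.sum_congr rfl fun u _ => ?_
            rw [Finset.mul_sum]
            refine Finset.sum_congr rfl fun x _ => ?_
            rw [← mul_assoc]
            rfl)
    refine (Finset.sum_le_sum fun z _ => mul_le_mul_of_nonneg_left
      (SuccessiveDecoder.one_sub_prob_le _ mu m₁ mv (hout (z.1 m₁) (z.2.1 mu) (z.2.2 mv)))
      (hw.1 z)).trans ?_
    refine (le_of_eq (hlin _ _ _)).trans ?_
    dsimp only at b₁ b₂ b₃ ⊢
    linarith
  have hM : (0 : ℝ) < (Fintype.card (Fin M₁) : ℝ) *
      ((Fintype.card (Fin Mu) : ℝ) * (Fintype.card (Fin Mv) : ℝ)) := by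
    have := fun (k : ℕ) [NeZero k] => (Nat.cast_pos (α := ℝ)).2 (Nat.pos_of_ne_zero (NeZero.ne k))
    simp only [Fintype.card_fin]
    exact mul_pos (this M₁) (mul_pos (this Mu) (this Mv))
  set K : ℝ := (Fintype.card (Fin M₁) : ℝ) *
      ((Fintype.card (Fin Mu) : ℝ) * (Fintype.card (Fin Mv) : ℝ)) with hK
  calc _ = ∑ m₁, ∑ mu, ∑ mv, (1 / K) * ∑ z, w z * (1 - SuccessiveDecoder.prob
      (⟨ΛU (fun _ => ()) z.2.1, fun mu => Λ₁ (z.2.1 mu) z.1, fun mu m₁ =>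
        ΛV (fun i => (z.2.1 mu i, z.1 m₁ i)) z.2.2⟩ :
          SuccessiveDecoder (Fin Mu) (Fin M₁) (Fin Mv) (Fin n → d)) mu m₁ mv
      (output ρ (z.1 m₁) fun i => f (z.2.1 mu i) (z.2.2 mv i))) := by
        rw [expectedError_eq]
        simp only [avgError, ← hK, Finset.mul_sum]
        rw [Finset.sum_comm]
        refine Finset.sum_congr rfl fun m₁ _ => ?_
        rw [Finset.sum_comm]
        refine Finset.sum_congr rfl fun mu _ => ?_
        rw [Finset.sum_comm]
        exact Finset.sum_congr rfl fun mv _ => Finset.sum_congr rfl fun z _ =>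
          mul_left_comm _ _ _
    _ ≤ ∑ _m₁ : Fin M₁, ∑ _mu : Fin Mu, ∑ _mv : Fin Mv, (1 / K) * (6 * √ε) :=
        Finset.sum_le_sum fun m₁ _ => Finset.sum_le_sum fun mu _ => Finset.sum_le_sum fun mv _ =>
          mul_le_mul_of_nonneg_left (hbound m₁ mu mv) (by positivity)
    _ = 6 * √ε := by
        simp only [Finset.sum_const, Finset.card_univ, nsmul_eq_mul]
        rw [hK] at hM ⊢
        field_simp

/-- Derandomization. -/
lemma exists_avgError_le {n : ℕ} {M₁ Mu Mv : Type*} [Fintype M₁] [Fintype Mu] [Fintype Mv]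
    [DecidableEq M₁] [DecidableEq Mu] [DecidableEq Mv]
    (h₁ : p₁ ∈ stdSimplex ℝ X₁) (hU : pU ∈ stdSimplex ℝ U)
    (hV : pV ∈ stdSimplex ℝ V) {ε : ℝ}
    (Λ : (M₁ → Fin n → X₁) → (Mu → Fin n → U) → (Mv → Fin n → V) →
      SuccessiveDecoder Mu M₁ Mv (Fin n → d))
    (h : expectedError ρ f p₁ pU pV Λ ≤ ε) :
    ∃ cx cu cv, avgError ρ f cx cu cv (Λ cx cu cv) ≤ ε := by
  by_contra! hlt
  set w : (M₁ → Fin n → X₁) × (Mu → Fin n → U) × (Mv → Fin n → V) → ℝ :=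
    fun z => codebookProb p₁ z.1 * (codebookProb pU z.2.1 * codebookProb pV z.2.2) with hwdef
  have hw : w ∈ stdSimplex ℝ _ := prod_mem_stdSimplex (codebookProb_mem_stdSimplex h₁)
    (prod_mem_stdSimplex (codebookProb_mem_stdSimplex hU) (codebookProb_mem_stdSimplex hV))
  have e : expectedError ρ f p₁ pU pV Λ =
      ∑ z, w z * avgError ρ f z.1 z.2.1 z.2.2 (Λ z.1 z.2.1 z.2.2) :=
    expectedError_eq Λ
  obtain ⟨z, hz⟩ : ∃ z, 0 < w z := by
    by_contra! h0
    have := hw.2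
    rw [Finset.sum_eq_zero fun z _ => le_antisymm (h0 z) (hw.1 z)] at this
    exact zero_ne_one this
  have : ∑ z, w z * ε < ∑ z, w z * avgError ρ f z.1 z.2.1 z.2.2 (Λ z.1 z.2.1 z.2.2) :=
    Finset.sum_lt_sum (fun z _ => mul_le_mul_of_nonneg_left (hlt _ _ _).le (hw.1 z))
      ⟨z, Finset.mem_univ z, mul_lt_mul_of_pos_left (hlt _ _ _) hz⟩
  rw [← Finset.sum_mul, hw.2, one_mul, ← e] at this
  linarith

end Successive

/-! ### The erasure splitting and its information quantities. -/

section Splitting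

variable {X₁ V d : Type*} [Fintype X₁] [Fintype V] [Fintype d] [DecidableEq d]

/-- The law of the split variable `U`: a letter drawn from `p` with probability `b`, and an
erasure with probability `a`. -/
def splitProb (a b : ℝ) (p : V → ℝ) (u : Option V) : ℝ := u.elim a fun v => b * p v

variable {a b : ℝ} {p : V → ℝ}

lemma sum_splitProb (F : Option V → ℝ) :
    ∑ u, splitProb a b p u * F u = a * F none + b * ∑ v, p v * F (some v) := by
  rw [Fintype.sum_option, Finset.mul_sum]
  simp only [splitProb, Option.elim, mul_assoc]

lemma splitProb_mem_stdSimplex (ha : 0 ≤ a) (hb : 0 ≤ b) (hab : a + b = 1)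
    (hp : p ∈ stdSimplex ℝ V) : splitProb a b p ∈ stdSimplex ℝ (Option V) := by
  constructor
  · rintro (_ | v)
    · exact ha
    · exact mul_nonneg hb (hp.1 v)
  · have h := sum_splitProb (a := a) (b := b) (p := p) fun _ => 1
    simp only [mul_one, hp.2] at h
    rw [h, hab]

lemma avgState_const (hp : p ∈ stdSimplex ℝ V) (A : Matrix d d ℂ) :
    avgState p (fun _ => A) = A := by
  rw [avgState, ← Finset.sum_smul]
  have : ∑ v, (p v : ℂ) = 1 := by exact_mod_cast hp.2
  rw [this, one_smul]

lemma holevo_const (hp : p ∈ stdSimplex ℝ V) (A : Matrix d d ℂ) :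
    holevo p (fun _ => A) = 0 := by
  rw [holevo, avgState_const hp, ← Finset.sum_mul, hp.2, one_mul, sub_self]

lemma avgState_comm (p₁ : X₁ → ℝ) (p : V → ℝ) (ρ : X₁ → V → Matrix d d ℂ) :
    avgState p₁ (fun x => avgState p (ρ x)) = avgState p fun v => avgState p₁ fun x => ρ x v := by
  simp only [avgState, Finset.smul_sum]
  rw [Finset.sum_comm]
  exact Finset.sum_congr rfl fun _ _ => Finset.sum_congr rfl fun _ _ => smul_comm _ _ _

/-- Erasure replaces the letter by a fresh one of the same law, so mixing it with the unerased case
does not change the mean. -/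
lemma avgState_splitProb (hab : a + b = 1) {σ : Option V → Matrix d d ℂ}
    (h : σ none = avgState p fun v => σ (some v)) :
    avgState (splitProb a b p) σ = σ none := by
  have e : avgState (splitProb a b p) σ = (a : ℂ) • σ none +
      (b : ℂ) • avgState p fun v => σ (some v) := by
    simp only [avgState, Fintype.sum_option, Finset.smul_sum, splitProb, Option.elim, smul_smul]
    push_cast
    rfl
  rw [e, ← h, ← add_smul]
  have : (a : ℂ) + b = 1 := by exact_mod_cast hab
  rw [this, one_smul]

variable {ρ : X₁ → V → Matrix d d ℂ} {p₁ : X₁ → ℝ}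

lemma holevo_splitProb (hp : p ∈ stdSimplex ℝ V) (hab : a + b = 1) :
    holevo (splitProb a b p) (fun u => avgState p₁ fun x => avgState p fun v => ρ x (u.getD v)) =
      b * holevo p fun v => avgState p₁ fun x => ρ x v := by
  have h : (avgState p₁ fun x => avgState p fun v => ρ x v) =
      avgState p fun v => avgState p₁ fun x => avgState p fun _ => ρ x v := by
    simp only [avgState_const hp]
    exact avgState_comm _ _ _
  rw [holevo, avgState_splitProb hab h, sum_splitProb]
  simp only [Option.getD_none, Option.getD_some, avgState_const hp, holevo]
  rw [avgState_comm, show a = 1 - b by linarith]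
  ring

/-- An erased `u` leaves the second input averaged over `p`; otherwise `u` is that input and
averaging over V does nothing. -/
lemma sum_splitProb_mul_holevo (hp : p ∈ stdSimplex ℝ V) :
    ∑ u, splitProb a b p u * holevo p₁ (fun x => avgState p fun v => ρ x (u.getD v)) =
      a * holevo p₁ (fun x => avgState p (ρ x)) + b * ∑ v, p v * holevo p₁ fun x => ρ x v := by
  rw [sum_splitProb]
  simp only [Option.getD_none, Option.getD_some, avgState_const hp]

/-- Unless `u` is erased the output does not depend on V, so only the erased part contributes. -/
lemma sum_splitProb_prod_mul_holevo (hp : p ∈ stdSimplex ℝ V) :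
    ∑ s : Option V × X₁, splitProb a b p s.1 * p₁ s.2 *
        holevo p (fun v => ρ s.2 (s.1.getD v)) = a * ∑ x, p₁ x * holevo p (ρ x) := by
  simp only [Fintype.sum_prod_type, mul_assoc, ← Finset.mul_sum]
  rw [sum_splitProb]
  simp only [Option.getD_none, Option.getD_some, holevo_const hp, mul_zero,
    Finset.sum_const_zero, add_zero]

variable {X₂ : Type*} [Fintype X₂] (e : V ≃ X₂)

lemma avgState_equiv (p : X₂ → ℝ) (σ : X₂ → Matrix d d ℂ) :
    avgState (fun v => p (e v)) (fun v => σ (e v)) = avgState p σ :=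
  Equiv.sum_comp e fun x => (p x : ℂ) • σ x

lemma holevo_equiv (p : X₂ → ℝ) (σ : X₂ → Matrix d d ℂ) :
    holevo (fun v => p (e v)) (fun v => σ (e v)) = holevo p σ := by
  rw [holevo, avgState_equiv, Equiv.sum_comp e fun x => p x * entropy (σ x), holevo]

lemma stdSimplex_equiv {p : X₂ → ℝ} (hp : p ∈ stdSimplex ℝ X₂) :
    (fun v => p (e v)) ∈ stdSimplex ℝ V :=
  ⟨fun _ => hp.1 _, (Equiv.sum_comp e p).trans hp.2⟩

lemma mixesTo_split (hab : a + b = 1) {p : X₂ → ℝ} (hp : p ∈ stdSimplex ℝ X₂) :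
    MixesTo (fun u v => e (Option.getD u v)) (splitProb a b fun v => p (e v))
      (fun v => p (e v)) p := by
  classical
  intro x
  have h1 : ∀ (u : Option V) (v : V), (if e (u.getD v) = x then
      splitProb a b (fun v => p (e v)) u * p (e v) else 0) =
      splitProb a b (fun v => p (e v)) u * if e (u.getD v) = x then p (e v) else 0 :=
    fun u v => by split_ifs <;> simp
  have h2 : ∑ v, (if e v = x then p (e v) else 0) = p x := by
    rw [Equiv.sum_comp e fun y => if y = x then p y else 0]
    simp
  have h3 : ∀ w : V, ∑ v, (if e w = x then p (e v) else 0) = if e w = x then 1 else 0 :=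
    fun w => by split_ifs
                · exact (stdSimplex_equiv e hp).2
                · simp
  calc _ = ∑ u, splitProb a b (fun v => p (e v)) u *
        ∑ v, if e (u.getD v) = x then p (e v) else 0 := by
        simp only [Finset.mul_sum]
        refine Finset.sum_congr rfl fun u _ => Finset.sum_congr rfl fun v _ => ?_
        rw [← h1]
    _ = p x := by
        rw [sum_splitProb]
        simp only [Option.getD_none, Option.getD_some, h2, h3, mul_ite, mul_one, mul_zero]
        rw [← add_mul, hab, one_mul]

end Splitting

/-! ### Message counts, achievability and the conclusion. -/

lemma numMsg_pos (n : ℕ) (R : ℝ) : 0 < numMsg n R :=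
  Nat.ceil_pos.2 (by positivity)

/-- Only the wrong codewords enter the packing bound; subtracting one absorbs the ceiling and covers
negative rates, where a single message remains. -/
lemma numMsg_sub_one_le (n : ℕ) (R : ℝ) : (numMsg n R : ℝ) - 1 ≤ 2 ^ (n * R) := by
  have := Nat.ceil_lt_add_one (a := (2 : ℝ) ^ ((n : ℝ) * R)) (by positivity)
  rw [numMsg]
  linarith

/-- Achievability by successive decoding at rates below the three information quantities. -/
theorem exists_successiveDecoder {X₁ X₂ U V d : Type*} [Fintype X₁] [Fintype U] [Fintype V]
    [Fintype d] [DecidableEq d] {ρ : X₁ → X₂ → Matrix d d ℂ}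
    (hρ : ∀ x₁ x₂, IsDensity (ρ x₁ x₂)) {f : U → V → X₂} {p₁ : X₁ → ℝ}
    (h₁ : p₁ ∈ stdSimplex ℝ X₁) {pU : U → ℝ} (hU : pU ∈ stdSimplex ℝ U) {pV : V → ℝ}
    (hV : pV ∈ stdSimplex ℝ V) {Ru R₁ Rv : ℝ}
    (hRu : Ru < holevo pU fun u => avgState p₁ fun x => avgState pV fun v => ρ x (f u v))
    (hR₁ : R₁ < ∑ u, pU u * holevo p₁ fun x => avgState pV fun v => ρ x (f u v))
    (hRv : Rv < ∑ s : U × X₁, pU s.1 * p₁ s.2 * holevo pV fun v => ρ s.2 (f s.1 v))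
    {ε : ℝ} (hε : 0 < ε) :
    ∃ N : ℕ, ∀ n ≥ N, ∃ Λ : (Fin (numMsg n R₁) → Fin n → X₁) →
        (Fin (numMsg n Ru) → Fin n → U) → (Fin (numMsg n Rv) → Fin n → V) →
        SuccessiveDecoder (Fin (numMsg n Ru)) (Fin (numMsg n R₁)) (Fin (numMsg n Rv)) (Fin n → d),
      expectedError ρ f p₁ pU pV Λ ≤ ε := by
  -- Chosen so that the combined bound 6 √((ε/6)²) is exactly ε.
  have hε' : 0 < (ε / 6) ^ 2 := by positivity
  have hone : (fun _ : Unit => (1 : ℝ)) ∈ stdSimplex ℝ Unit := by simp [stdSimplex]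
  have hW : ∀ u x, IsDensity (avgState pV fun v => ρ x (f u v)) := fun u x =>
    isDensity_avgState hV fun v => hρ _ _
  obtain ⟨N₁, hN₁⟩ := exists_decoder_sideInformation
    (ρ := fun (_ : Unit) u => avgState p₁ fun x => avgState pV fun v => ρ x (f u v))
    (fun _ u => isDensity_avgState h₁ (hW u)) hone hU (R := Ru) (by simpa using hRu) hε'
  obtain ⟨N₂, hN₂⟩ := exists_decoder_sideInformation
    (ρ := fun u x => avgState pV fun v => ρ x (f u v)) hW hU h₁ hR₁ hε'
  obtain ⟨N₃, hN₃⟩ := exists_decoder_sideInformation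
    (ρ := fun (s : U × X₁) v => ρ s.2 (f s.1 v)) (fun _ _ => hρ _ _)
    (prod_mem_stdSimplex hU h₁) hV hRv hε'
  refine ⟨max N₁ (max N₂ N₃), fun n hn => ?_⟩
  simp only [ge_iff_le, max_le_iff] at hn
  obtain ⟨ΛU, hΛU⟩ := hN₁ n hn.1 _ (numMsg_pos n Ru) (numMsg_sub_one_le n Ru)
  obtain ⟨Λ₁, hΛ₁⟩ := hN₂ n hn.2.1 _ (numMsg_pos n R₁) (numMsg_sub_one_le n R₁)
  obtain ⟨ΛV, hΛV⟩ := hN₃ n hn.2.2 _ (numMsg_pos n Rv) (numMsg_sub_one_le n Rv)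
  have : NeZero (numMsg n Ru) := ⟨(numMsg_pos n Ru).ne'⟩
  have : NeZero (numMsg n R₁) := ⟨(numMsg_pos n R₁).ne'⟩
  have : NeZero (numMsg n Rv) := ⟨(numMsg_pos n Rv).ne'⟩
  have h := expectedError_le hρ h₁ hU hV hΛU hΛ₁ hΛV
  rw [Real.sqrt_sq (by positivity)] at h
  exact ⟨_, h.trans (by linarith)⟩

end CQMac

theorem mainTheorem7 {X₁ X₂ d : Type*} [Fintype X₁] [DecidableEq X₁]
    [Fintype X₂] [DecidableEq X₂] [Fintype d] [DecidableEq d]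
    (ρ : X₁ → X₂ → Matrix d d ℂ) (hρ : ∀ x₁ x₂, CQMac.IsDensity (ρ x₁ x₂))
    (p₁ : X₁ → ℝ) (hp₁ : p₁ ∈ stdSimplex ℝ X₁)
    (p₂ : X₂ → ℝ) (hp₂ : p₂ ∈ stdSimplex ℝ X₂)
    (R₁ R₂ : ℝ)
    (hR : (R₁, R₂) ∈ segment ℝ (CQMac.alphaCorner ρ p₁ p₂) (CQMac.betaCorner ρ p₁ p₂)) :
    ∃ (U V : Type) (_ : Fintype U) (_ : Fintype V) (pU : U → ℝ) (pV : V → ℝ) (f : U → V → X₂)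
      (Ru Rv : ℝ),
      pU ∈ stdSimplex ℝ U ∧ pV ∈ stdSimplex ℝ V ∧ CQMac.MixesTo f pU pV p₂ ∧
      0 ≤ Ru ∧ 0 ≤ Rv ∧ Ru + Rv = R₂ ∧
      ∀ ε > 0, ∀ δ > 0, ∃ N : ℕ, ∀ n ≥ N, ∀ M₁ Mu Mv : ℕ,
        M₁ = CQMac.numMsg n (R₁ - δ) →
        Mu = CQMac.numMsg n (Ru - δ / 2) →
        Mv = CQMac.numMsg n (Rv - δ / 2) →
        (∃ Λ : (Fin M₁ → Fin n → X₁) → (Fin Mu → Fin n → U) → (Fin Mv → Fin n → V) →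
            CQMac.SuccessiveDecoder (Fin Mu) (Fin M₁) (Fin Mv) (Fin n → d),
          CQMac.expectedError ρ f p₁ pU pV Λ ≤ ε) ∧
        (∃ (cx : Fin M₁ → Fin n → X₁) (cu : Fin Mu → Fin n → U) (cv : Fin Mv → Fin n → V)
            (Λ : CQMac.SuccessiveDecoder (Fin Mu) (Fin M₁) (Fin Mv) (Fin n → d)),
          CQMac.avgError ρ f cx cu cv Λ ≤ ε) := by
  open CQMac in
  obtain ⟨a, b, ha, hb, hab, hseg⟩ := hR
  simp only [alphaCorner, betaCorner, Prod.smul_mk, Prod.mk_add_mk, Prod.mk.injEq, smul_eq_mul,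
    infoX₁_theta hρ hp₂, infoX₂_theta hρ hp₁, infoX₁GivenX₂_theta hρ hp₁ hp₂,
    infoX₂GivenX₁_theta hρ hp₁ hp₂] at hseg
  obtain ⟨hR₁, hR₂⟩ := hseg
  -- The auxiliary alphabets must live in `Type`, whereas `X₂` may be in any universe.
  let e : Fin (Fintype.card X₂) ≃ X₂ := (Fintype.equivFin X₂).symm
  have hV := stdSimplex_equiv e hp₂
  have hU := splitProb_mem_stdSimplex ha hb hab hV
  have iU := holevo_splitProb (ρ := fun x v => ρ x (e v)) (p₁ := p₁) hV hab
  have i₁ := sum_splitProb_mul_holevo (ρ := fun x v => ρ x (e v)) (p₁ := p₁) (a := a) (b := b) hV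
  have iV := sum_splitProb_prod_mul_holevo (ρ := fun x v => ρ x (e v)) (p₁ := p₁)
    (a := a) (b := b) hV
  rw [holevo_equiv e p₂ fun y => avgState p₁ fun x => ρ x y] at iU
  rw [Equiv.sum_comp e fun y => p₂ y * holevo p₁ fun x => ρ x y] at i₁
  simp only [avgState_equiv e p₂ (ρ _)] at i₁
  simp only [holevo_equiv e p₂ (ρ _)] at iV
  rw [hR₁] at i₁
  refine ⟨Option (Fin (Fintype.card X₂)), Fin (Fintype.card X₂), inferInstance, inferInstance,
    splitProb a b fun v => p₂ (e v), fun v => p₂ (e v), fun u v => e (u.getD v),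
    b * holevo p₂ fun y => avgState p₁ fun x => ρ x y,
    a * ∑ x, p₁ x * holevo p₂ (ρ x), hU, hV, mixesTo_split e hab hp₂,
    mul_nonneg hb (holevo_nonneg hp₂ fun y => isDensity_avgState hp₁ fun x => hρ x y),
    mul_nonneg ha (Finset.sum_nonneg fun x _ =>
      mul_nonneg (hp₁.1 x) (holevo_nonneg hp₂ (hρ x))), by rw [← hR₂]; ring, ?_⟩
  intro ε hε δ hδ
  -- The three informations equal the split rates exactly, so subtracting δ or δ/2 gives the
  -- required strict inequalities.
  obtain ⟨N, hN⟩ := exists_successiveDecoder hρ (f := fun u v => e (Option.getD u v)) hp₁ hU hV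
    ((sub_lt_self _ (half_pos hδ)).trans_eq iU.symm) ((sub_lt_self _ hδ).trans_eq i₁.symm)
    ((sub_lt_self _ (half_pos hδ)).trans_eq iV.symm) hε
  refine ⟨N, fun n hn M₁ Mu Mv h₁ hu hv => ?_⟩
  subst h₁ hu hv
  obtain ⟨Λ, hΛ⟩ := hN n hn
  obtain ⟨cx, cu, cv, h⟩ := exists_avgError_le hp₁ hU hV Λ hΛ
  exact ⟨⟨Λ, hΛ⟩, cx, cu, cv, Λ cx cu cv, h⟩
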